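/- Let $K$ be the transition matrix of an irreducible birth and death chain on $\{0,1,\dots,n\}$: $K(i,i+1)=p_i$, $K(i,i-1)=q_i$, $K(i,i)=r_i$, where $p_i,q_i,r_i\ge 0$, $p_i+q_i+r_i=1$ and $p_n=q_0=0$. Let $\pi$ be its stationary distribution, write $\pi(A)=\sum_{i\in A}\pi(i)$, and let $i_0$ be a state with $\pi([0,i_0])\ge 1/2$ and $\pi([i_0,n])\ge 1/2$. Set $$t=\max\Big\{\sum_{k=0}^{i_0-1}\frac{\pi([0,k])}{\pi(k)p_k},\ \sum_{k=i_0+1}^{n}\frac{\pi([k,n])}{\pi(k)q_k}\Big\}.$$ Let $T^{(c)}(\epsilon)$ be the infimum of the reals $s\ge 0$ such that $\max_x\|e^{-s(I-K)}(x,\cdot)-\pi\|_{TV}\le\epsilon$ and, for $\delta\in(0,1)$, let $T^{(\delta)}(\epsilon)$ be the infimum of the integers $m\ge 0$ such that $\max_x\|K_\delta^m(x,\cdot)-\pi\|_{TV}\le\epsilon$, where $K_\delta=\delta I+(1-\delta)K$ and $\|\mu-\nu\|_{TV}=\max_A(\mu(A)-\nu(A))$. Let $\tau_{i_0}=\min\{m\ge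 0: X_m=i_0\}$ for the Markov chain $(X_m)_{m\ge0}$ with transition matrix $K$, and let $\mathbb E_i$ denote expectation given $X_0=i$. Then $$t=\max\{\mathbb E_0\tau_{i_0},\ \mathbb E_n\tau_{i_0}\},$$ and for every $\delta\in[1/2,1)$: (1) $\min\{T^{(c)}(1/10),\,T^{(\delta)}(1/20)\}\ge t/6$, and moreover $2(1-\delta)\,T^{(\delta)}(1/20)\ge t/6$; (2) for every $\epsilon\in(0,1)$, $$\max\{T^{(c)}(\epsilon),\,(1-\delta)T^{(\delta)}(\epsilon)\}\le\frac{9(\mathbb E_0\tau_{i_0}+\mathbb E_n\tau_{i_0})}{\epsilon^2}\quad\text{and}\quad\max\{T^{(c)}(\epsilon),\,2(1-\delta)T^{(\delta)}(\epsilon)\}\le\frac{18\,t}{\epsilon^2}.$$ -/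

import Mathlib

open scoped ENNReal NNReal

/-- Rates of a birth and death chain on the states `0, 1, ..., n` (modelled by `Fin (n + 1)`):
`p i` is the birth rate, `q i` the death rate and `r i` the holding rate at `i`. -/
structure BirthDeathChain (n : ℕ) where
  p : Fin (n + 1) → ℝ
  q : Fin (n + 1) → ℝ
  r : Fin (n + 1) → ℝ
  p_nonneg : ∀ i, 0 ≤ p i
  q_nonneg : ∀ i, 0 ≤ q i
  r_nonneg : ∀ i, 0 ≤ r i
  sum_eq_one : ∀ i, p i + q i + r i = 1
  p_last : p (Fin.last n) = 0
  q_zero : q 0 = 0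

namespace BirthDeathChain

/-- The transition matrix: `K(i, i+1) = p_i`, `K(i, i-1) = q_i`, `K(i, i) = r_i`, and all other
entries vanish. -/
def K {n : ℕ} (C : BirthDeathChain n) : Matrix (Fin (n + 1)) (Fin (n + 1)) ℝ :=
  Matrix.of fun i j =>
    if (j : ℕ) = (i : ℕ) + 1 then C.p i
    else if (i : ℕ) = (j : ℕ) + 1 then C.q i
    else if j = i then C.r i
    else 0

theorem K_nonneg {n : ℕ} (C : BirthDeathChain n) (i j : Fin (n + 1)) : 0 ≤ C.K i j := by
  simp only [K, Matrix.of_apply]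
  split_ifs
  exacts [C.p_nonneg i, C.q_nonneg i, C.r_nonneg i, le_refl 0]

theorem sum_up {n : ℕ} (C : BirthDeathChain n) (i : Fin (n + 1)) :
    ∑ j : Fin (n + 1), (if (j : ℕ) = (i : ℕ) + 1 then C.p i else 0) = C.p i := by
  by_cases h : (i : ℕ) + 1 < n + 1
  · rw [Finset.sum_eq_single (⟨(i : ℕ) + 1, h⟩ : Fin (n + 1))]
    · simp
    · intro b _ hb
      rw [if_neg]
      intro hb'
      exact hb (Fin.ext hb')
    · simp
  · have hi : i = Fin.last n := by
      apply Fin.ext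
      have := i.isLt
      simp only [Fin.val_last]
      omega
    have hp : C.p i = 0 := by rw [hi]; exact C.p_last
    simp [hp]

theorem sum_down {n : ℕ} (C : BirthDeathChain n) (i : Fin (n + 1)) :
    ∑ j : Fin (n + 1), (if (i : ℕ) = (j : ℕ) + 1 then C.q i else 0) = C.q i := by
  by_cases h : (i : ℕ) = 0
  · have hi : i = 0 := Fin.ext h
    have hq : C.q i = 0 := by rw [hi]; exact C.q_zero
    simp [hq]
  · have hlt : (i : ℕ) - 1 < n + 1 := by have := i.isLt; omega
    rw [Finset.sum_eq_single (⟨(i : ℕ) - 1, hlt⟩ : Fin (n + 1))]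
    · rw [if_pos]
      simp only
      omega
    · intro b _ hb
      rw [if_neg]
      intro hb'
      apply hb
      apply Fin.ext
      simp only
      omega
    · simp

theorem K_row_sum {n : ℕ} (C : BirthDeathChain n) (i : Fin (n + 1)) :
    ∑ j, C.K i j = 1 := by
  have h : ∀ j, C.K i j = (if (j : ℕ) = (i : ℕ) + 1 then C.p i else 0) +
      (if (i : ℕ) = (j : ℕ) + 1 then C.q i else 0) + (if j = i then C.r i else 0) := by
    intro j
    simp only [K, Matrix.of_apply, Fin.ext_iff]
    split_ifs <;> first | omega | simp
  simp only [h, Finset.sum_add_distrib, C.sum_up, C.sum_down]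
  simp [C.sum_eq_one]

/-- The law `K(i, ·)` of one step of the chain from `i`. -/
noncomputable def stepPMF {n : ℕ} (C : BirthDeathChain n) (i : Fin (n + 1)) :
    PMF (Fin (n + 1)) :=
  PMF.ofFintype (fun j => ENNReal.ofReal (C.K i j)) (by
    rw [← ENNReal.ofReal_sum_of_nonneg (fun j _ => C.K_nonneg i j), C.K_row_sum i,
      ENNReal.ofReal_one])

/-- The transition kernel at time `m`: given the past `x_0, ..., x_m`, the next state is
distributed according to `K(x_m, ·)`. -/
noncomputable def stepKernel {n : ℕ} (C : BirthDeathChain n) (m : ℕ) :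
    ProbabilityTheory.Kernel (Finset.Iic m → Fin (n + 1)) (Fin (n + 1)) where
  toFun x := (C.stepPMF (x ⟨m, Finset.mem_Iic.2 le_rfl⟩)).toMeasure
  measurable' := (measurable_of_countable fun i => (C.stepPMF i).toMeasure).comp
    (measurable_pi_apply _)

instance {n : ℕ} (C : BirthDeathChain n) (m : ℕ) :
    ProbabilityTheory.IsMarkovKernel (C.stepKernel m) :=
  ⟨fun x => PMF.toMeasure.isProbabilityMeasure
    (C.stepPMF (x ⟨m, Finset.mem_Iic.2 le_rfl⟩))⟩

/-- The law `ℙ_i` on trajectories `(X_m)_{m ≥ 0}` of the Markov chain with transition matrix `K`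
and `X_0 = i`. -/
noncomputable def pathMeasure {n : ℕ} (C : BirthDeathChain n) (i : Fin (n + 1)) :
    MeasureTheory.Measure (ℕ → Fin (n + 1)) :=
  ProbabilityTheory.Kernel.traj (X := fun _ => Fin (n + 1)) C.stepKernel 0 (fun _ => i)

end BirthDeathChain

/-- The first passage time `τ_j = min {m ≥ 0 | X_m = j}` of a trajectory (`∞` if `j` is never
visited). -/
noncomputable def firstPassage {S : Type*} (j : S) (x : ℕ → S) : ℝ≥0∞ :=
  ⨅ (m : ℕ) (_ : x m = j), (m : ℝ≥0∞)

/-- The expected first passage time `𝔼_i τ_j`. -/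
noncomputable def BirthDeathChain.meanPassage {n : ℕ} (C : BirthDeathChain n)
    (i j : Fin (n + 1)) : ℝ≥0∞ :=
  ∫⁻ x, firstPassage j x ∂(C.pathMeasure i)

/-- `π` is a stationary distribution of the transition matrix `K`. -/
structure IsStationaryDistribution {S : Type*} [Fintype S] (K : Matrix S S ℝ) (π : S → ℝ) :
    Prop where
  nonneg : ∀ i, 0 ≤ π i
  sum_eq_one : ∑ i, π i = 1
  stationary : Matrix.vecMul π K = π

/-- Total variation distance `sup {μ(A) - ν(A) | A ⊆ S}` on a finite set `S`. -/
noncomputable def tvDist {S : Type*} (μ ν : S → ℝ) : ℝ :=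
  ⨆ A : Finset S, (∑ i ∈ A, μ i - ∑ i ∈ A, ν i)

/-- The maximal total variation distance `sup_x ‖P(x, ·) - π‖_TV` to `π` of the rows of `P`. -/
noncomputable def maxTVDist {S : Type*} (P : Matrix S S ℝ) (π : S → ℝ) : ℝ :=
  ⨆ x : S, tvDist (P x) π

/-- The `δ`-lazy version `δ I + (1 - δ) K` of `K`. -/
def lazyMatrix {S : Type*} [DecidableEq S] (K : Matrix S S ℝ) (δ : ℝ) : Matrix S S ℝ :=
  δ • (1 : Matrix S S ℝ) + (1 - δ) • K

/-- The continuous time semigroup `H_t = exp (-t (I - K))`. -/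
noncomputable def heatSemigroup {S : Type*} [Fintype S] [DecidableEq S] (K : Matrix S S ℝ)
    (t : ℝ) : Matrix S S ℝ :=
  NormedSpace.exp (-(t • (1 - K)))

/-- Mixing time of the discrete time chain with transition matrix `K`: the infimum of all integers
`m ≥ 0` with `sup_x ‖K^m(x, ·) - π‖_TV ≤ ε`; it is `∞` if there are none. -/
noncomputable def mixingTime {S : Type*} [Fintype S] [DecidableEq S] (K : Matrix S S ℝ)
    (π : S → ℝ) (ε : ℝ) : ℝ≥0∞ :=
  ⨅ (m : ℕ) (_ : maxTVDist (K ^ m) π ≤ ε), (m : ℝ≥0∞)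

/-- Mixing time of the continuous time chain: the infimum of all real `t ≥ 0` with
`sup_x ‖H_t(x, ·) - π‖_TV ≤ ε`; it is `∞` if there are none. -/
noncomputable def mixingTimeCts {S : Type*} [Fintype S] [DecidableEq S] (K : Matrix S S ℝ)
    (π : S → ℝ) (ε : ℝ) : ℝ≥0∞ :=
  ⨅ (t : ℝ≥0) (_ : maxTVDist (heatSemigroup K (t : ℝ)) π ≤ ε), (t : ℝ≥0∞)

/-- The quantity
`max {∑_{k < i₀} π([0,k]) / (π(k) p_k), ∑_{k > i₀} π([k,n]) / (π(k) q_k)}`. -/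
noncomputable def BirthDeathChain.tMax {n : ℕ} (C : BirthDeathChain n) (π : Fin (n + 1) → ℝ)
    (i₀ : Fin (n + 1)) : ℝ :=
  max (∑ k ∈ Finset.Iio i₀, (∑ j ∈ Finset.Iic k, π j) / (π k * C.p k))
    (∑ k ∈ Finset.Ioi i₀, (∑ j ∈ Finset.Ici k, π j) / (π k * C.q k))

/-!
Everything is expressed through the function `h = hitMean`, the closed form of the mean hitting
time of `i₀`. A direct computation with detailed balance shows `h - K h = 1` off `i₀`, so
`ℙ_x(τ > m)`, which satisfies the first-step recursion `survival`, sums over `m` to `h x`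
(`hasSum_survival`, `meanPassage_eq`). As `h` is largest at an endpoint, this gives
`t = max h = max {𝔼_0 τ, 𝔼_n τ}`.

*Lower bounds.* The part `g` of `h` to the left of `i₀` satisfies `g - K g ≤ 1` everywhere, hence
the lazy chain `P = K_δ` decreases it by at most `(1 - δ) m` in `m` steps. On the other hand `g` is
maximal at `0` and supported on `[0, i₀)`, which has mass at most `1/2`; if the distance to `π` is
at most `η`, then `P^m g (0) ≤ (1/2 + η) g 0`, so `(1/2 - η) g 0 ≤ (1 - δ) m`. The right part is
symmetric (`tMax_mul_le`).

*Upper bounds.* By a decomposition at the first visit to `i₀` (`abs_pow_add_mulVec_le`), the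
distance to `π` after `u + v` steps is at most `ℙ_x(τ > u)`, bounded by Markov's inequality
(`mul_survival_le`), plus the distance after at least `v` steps from `i₀`. The latter is controlled
in `ℓ²(π)`: `∑_j (P^j(i₀, i₀) / π(i₀) - 1)` is at most `π(h) / (1 - δ) ≤ t / (1 - δ)`, and for
`δ ≥ 1/2` its terms are nonnegative and decrease along even `j`
(`DetailedBalance.mul_sq_pow_mulVec_le`). The bound from `i₀` therefore decays like the square root
of `t / ((1 - δ) v)`, which is where `1 / ε²` comes from.

*Continuous time.* The matrices `K_{1 - s/m}^m` converge to `exp (-s (I - K))`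
(`tendsto_lazyMatrix_pow_heatSemigroup`), and the bounds above depend on `δ` and `m` only through
`(1 - δ) m`, so they pass to the limit.
-/

open Matrix Finset

/-! ### Row-stochastic matrices acting on functions -/

section Stochastic

variable {S : Type*} [Fintype S] [DecidableEq S] {P : Matrix S S ℝ}

theorem mulVec_mono_of_rowStochastic (hP : P ∈ rowStochastic ℝ S) {f g : S → ℝ}
    (h : ∀ x, f x ≤ g x) (x : S) : (P *ᵥ f) x ≤ (P *ᵥ g) x :=
  Finset.sum_le_sum fun y _ => mul_le_mul_of_nonneg_left (h y) (hP.1 x y)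

theorem mulVec_const_of_rowStochastic (hP : P ∈ rowStochastic ℝ S) (c : ℝ) (x : S) :
    (P *ᵥ fun _ => c) x = c := by
  simp only [mulVec, dotProduct]
  rw [← Finset.sum_mul, sum_row_of_mem_rowStochastic hP, one_mul]

theorem abs_mulVec_le_of_rowStochastic (hP : P ∈ rowStochastic ℝ S) {f g : S → ℝ}
    (h : ∀ x, |f x| ≤ g x) (x : S) : |(P *ᵥ f) x| ≤ (P *ᵥ g) x := by
  refine (Finset.abs_sum_le_sum_abs _ _).trans (Finset.sum_le_sum fun y _ => ?_)
  rw [abs_mul, abs_of_nonneg (hP.1 x y)]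
  exact mul_le_mul_of_nonneg_left (h y) (hP.1 x y)

/-- A function whose one-step drift is at least `-c` decreases by at most `m c` in `m` steps. -/
theorem sub_pow_mulVec_le (hP : P ∈ rowStochastic ℝ S) {g : S → ℝ} {c : ℝ}
    (h : ∀ x, g x - (P *ᵥ g) x ≤ c) (m : ℕ) (x : S) : g x - (P ^ m *ᵥ g) x ≤ m * c := by
  induction m generalizing x with
  | zero => simp
  | succ m ih =>
    have h1 : ∀ y, g y ≤ (P *ᵥ g) y + c := fun y => by linarith [h y]
    have h2 := mulVec_mono_of_rowStochastic (pow_mem hP m) h1 x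
    have h3 : (P ^ m *ᵥ fun y => (P *ᵥ g) y + c) x = (P ^ (m + 1) *ᵥ g) x + c := by
      have : (fun y => (P *ᵥ g) y + c) = P *ᵥ g + fun _ => c := rfl
      rw [this, mulVec_add, Pi.add_apply, mulVec_const_of_rowStochastic (pow_mem hP m),
        mulVec_mulVec, pow_succ]
    rw [h3] at h2
    push_cast
    linarith [ih x]

/-! ### Survival probabilities -/

/-- `survival P a m x` is the probability that the chain with transition matrix `P` started at `x`
has not visited `a` by time `m`, defined through the first-step recursion. -/
def survival (P : Matrix S S ℝ) (a : S) : ℕ → S → ℝ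
  | 0 => fun x => if x = a then 0 else 1
  | m + 1 => fun x => if x = a then 0 else (P *ᵥ survival P a m) x

theorem survival_self (P : Matrix S S ℝ) (a : S) (m : ℕ) : survival P a m a = 0 := by
  cases m <;> simp [survival]

theorem survival_nonneg (hP : P ∈ rowStochastic ℝ S) (a : S) (m : ℕ) (x : S) :
    0 ≤ survival P a m x := by
  induction m generalizing x with
  | zero => simp only [survival]; split_ifs <;> norm_num
  | succ m ih =>
    simp only [survival]
    split_ifs
    · exact le_rfl
    · exact nonneg_mulVec_of_mem_rowStochastic hP ih x

theorem survival_succ_le (hP : P ∈ rowStochastic ℝ S) (a : S) (m : ℕ) (x : S) :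
    survival P a (m + 1) x ≤ survival P a m x := by
  induction m generalizing x with
  | zero =>
    simp only [survival]
    split_ifs
    · exact le_rfl
    · conv_rhs => rw [← mulVec_const_of_rowStochastic hP 1 x]
      refine mulVec_mono_of_rowStochastic hP (fun y => ?_) x
      split_ifs <;> norm_num
  | succ m ih =>
    by_cases h : x = a
    · subst h
      simp only [survival_self, le_refl]
    · simp only [survival.eq_2, if_neg h]
      exact mulVec_mono_of_rowStochastic hP ih x

theorem survival_antitone (hP : P ∈ rowStochastic ℝ S) (a : S) (x : S) :
    Antitone fun m => survival P a m x :=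
  antitone_nat_of_succ_le fun m => survival_succ_le hP a m x

/-- If `H` satisfies the mean hitting time equation `H = 1 + P H` off `a` and `H a = 0`, then `H`
is the truncated mean `∑_{j < u} ℙ(τ > j)` plus a remainder at most `t ℙ(τ > u)` when
`H ≤ t`. -/
theorem sum_survival_bounds (hP : P ∈ rowStochastic ℝ S) {a : S} {H : S → ℝ} {t : ℝ}
    (ha : H a = 0) (h0 : ∀ x, 0 ≤ H x) (ht : ∀ x, H x ≤ t)
    (hH : ∀ x, x ≠ a → H x - (P *ᵥ H) x = 1) (u : ℕ) (x : S) :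
    0 ≤ H x - ∑ j ∈ range u, survival P a j x ∧
      H x - ∑ j ∈ range u, survival P a j x ≤ t * survival P a u x := by
  induction u generalizing x with
  | zero =>
    simp only [range_zero, sum_empty, sub_zero, survival]
    refine ⟨h0 x, ?_⟩
    split_ifs with h
    · simp [h, ha]
    · simpa using ht x
  | succ u ih =>
    by_cases hx : x = a
    · subst hx
      simp [survival_self, ha]
    · have key : H x - ∑ j ∈ range (u + 1), survival P a j x =
          (P *ᵥ fun y => H y - ∑ j ∈ range u, survival P a j y) x := by
        have e : (fun y => H y - ∑ j ∈ range u, survival P a j y)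
            = H - ∑ j ∈ range u, survival P a j := by
          ext y; simp
        rw [e, mulVec_sub, mulVec_sum, sum_range_succ']
        simp only [survival, if_neg hx, Pi.sub_apply, Finset.sum_apply]
        linarith [hH x hx]
      rw [key]
      refine ⟨nonneg_mulVec_of_mem_rowStochastic hP (fun y => (ih y).1) x, ?_⟩
      refine (mulVec_mono_of_rowStochastic hP (fun y => (ih y).2) x).trans_eq ?_
      have e : (fun y => t * survival P a u y) = t • survival P a u := rfl
      simp only [e, mulVec_smul, survival, if_neg hx, Pi.smul_apply, smul_eq_mul]

/-- Markov's inequality for the hitting time of `a`. -/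
theorem mul_survival_le (hP : P ∈ rowStochastic ℝ S) {a : S} {H : S → ℝ} {t : ℝ}
    (ha : H a = 0) (h0 : ∀ x, 0 ≤ H x) (ht : ∀ x, H x ≤ t)
    (hH : ∀ x, x ≠ a → H x - (P *ᵥ H) x = 1) (u : ℕ) (x : S) :
    u * survival P a u x ≤ H x := by
  have h1 := (sum_survival_bounds hP ha h0 ht hH u x).1
  have h2 : ∑ _j ∈ range u, survival P a u x ≤ ∑ j ∈ range u, survival P a j x :=
    Finset.sum_le_sum fun j hj => survival_antitone hP a x (mem_range.1 hj).le
  rw [sum_const, card_range, nsmul_eq_mul] at h2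
  linarith

/-- The survival probabilities sum to the mean hitting time. -/
theorem hasSum_survival (hP : P ∈ rowStochastic ℝ S) {a : S} {H : S → ℝ} {t : ℝ}
    (ha : H a = 0) (h0 : ∀ x, 0 ≤ H x) (ht : ∀ x, H x ≤ t)
    (hH : ∀ x, x ≠ a → H x - (P *ᵥ H) x = 1) (x : S) :
    HasSum (fun j => survival P a j x) (H x) := by
  rw [hasSum_iff_tendsto_nat_of_nonneg (fun j => survival_nonneg hP a j x)]
  have ht0 : 0 ≤ t := (h0 x).trans (ht x)
  have hb : ∀ u : ℕ, 0 < u → |∑ j ∈ range u, survival P a j x - H x| ≤ (t * t) / u := by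
    intro u hu
    have hu' : (0 : ℝ) < u := Nat.cast_pos.2 hu
    obtain ⟨h1, h2⟩ := sum_survival_bounds hP ha h0 ht hH u x
    rw [abs_sub_comm, abs_of_nonneg h1, le_div_iff₀ hu']
    have h3 := mul_survival_le hP ha h0 ht hH u x
    calc (H x - ∑ j ∈ range u, survival P a j x) * u ≤ t * survival P a u x * u := by gcongr
      _ = t * (u * survival P a u x) := by ring
      _ ≤ t * t := mul_le_mul_of_nonneg_left (h3.trans (ht x)) ht0
  rw [tendsto_iff_norm_sub_tendsto_zero]
  refine squeeze_zero' (Filter.Eventually.of_forall fun _ => norm_nonneg _)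
    (Filter.eventually_atTop.2 ⟨1, fun u hu => ?_⟩) (tendsto_const_div_atTop_nhds_zero_nat (t * t))
  exact hb u hu

/-- Decomposition at the first visit to `a`: if `|P^j φ (a)| ≤ β` from time `v` on, then from any
starting point `|P^(v+u) φ| ≤ β + ℙ(τ > u)`. -/
theorem abs_pow_add_mulVec_le (hP : P ∈ rowStochastic ℝ S) {a : S} {φ : S → ℝ} {β : ℝ}
    (hφ : ∀ x, |φ x| ≤ 1) (hβ : 0 ≤ β) (v : ℕ)
    (h : ∀ j, v ≤ j → |(P ^ j *ᵥ φ) a| ≤ β) (u : ℕ) (x : S) :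
    |(P ^ (v + u) *ᵥ φ) x| ≤ β + survival P a u x := by
  induction u generalizing x with
  | zero =>
    by_cases hx : x = a
    · subst hx
      simpa [survival] using h v le_rfl
    · simp only [survival, if_neg hx, add_zero]
      have := abs_mulVec_le_of_rowStochastic (pow_mem hP v) hφ x
      rw [mulVec_const_of_rowStochastic (pow_mem hP v)] at this
      linarith
  | succ u ih =>
    by_cases hx : x = a
    · subst hx
      rw [survival_self, add_zero]
      exact h _ (Nat.le_add_right _ _)
    · have := abs_mulVec_le_of_rowStochastic hP ih x
      rw [mulVec_mulVec, ← pow_succ'] at this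
      refine this.trans_eq ?_
      have e : (fun y => β + survival P a u y) = (fun _ => β) + survival P a u := rfl
      rw [e, mulVec_add, Pi.add_apply, mulVec_const_of_rowStochastic hP]
      simp only [survival, if_neg hx]

end Stochastic

/-! ### Reversible chains in `ℓ²(π)` -/

section Reversible

variable {S : Type*} [Fintype S]

/-- The inner product of `ℓ²(π)`. -/
def weightedInner (π f g : S → ℝ) : ℝ := ∑ x, π x * f x * g x

theorem weightedInner_sub_right (π f g k : S → ℝ) :
    weightedInner π f (g - k) = weightedInner π f g - weightedInner π f k := by
  simp [weightedInner, mul_sub]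

theorem weightedInner_sub_left (π f g k : S → ℝ) :
    weightedInner π (f - g) k = weightedInner π f k - weightedInner π g k := by
  simp [weightedInner, mul_sub, sub_mul]

theorem weightedInner_self_nonneg {π : S → ℝ} (hπ : ∀ x, 0 ≤ π x) (f : S → ℝ) :
    0 ≤ weightedInner π f f :=
  Finset.sum_nonneg fun x _ => by
    rw [mul_assoc]; exact mul_nonneg (hπ x) (mul_self_nonneg _)

theorem weightedInner_sq_le {π : S → ℝ} (hπ : ∀ x, 0 ≤ π x) (f g : S → ℝ) :
    weightedInner π f g ^ 2 ≤ weightedInner π f f * weightedInner π g g := by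
  have h := Finset.sum_mul_sq_le_sq_mul_sq Finset.univ
    (fun x => Real.sqrt (π x) * f x) (fun x => Real.sqrt (π x) * g x)
  have e : ∀ f g : S → ℝ, ∑ x, (Real.sqrt (π x) * f x) * (Real.sqrt (π x) * g x)
      = weightedInner π f g := fun f g => Finset.sum_congr rfl fun x _ => by
    rw [mul_mul_mul_comm, Real.mul_self_sqrt (hπ x), mul_assoc]
  simpa only [e, pow_two (Real.sqrt _ * _)] using h

/-- Detailed balance of the transition matrix `P` with respect to `π`. -/
def DetailedBalance (P : Matrix S S ℝ) (π : S → ℝ) : Prop :=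
  ∀ x y, π x * P x y = π y * P y x

variable {P : Matrix S S ℝ} {π : S → ℝ}

theorem DetailedBalance.inner_mulVec (h : DetailedBalance P π) (f g : S → ℝ) :
    weightedInner π (P *ᵥ f) g = weightedInner π f (P *ᵥ g) := by
  simp only [weightedInner, mulVec, dotProduct, Finset.mul_sum, Finset.sum_mul]
  rw [Finset.sum_comm]
  refine Finset.sum_congr rfl fun x _ => Finset.sum_congr rfl fun y _ => ?_
  linear_combination (f x * g y) * h y x

variable [DecidableEq S]

theorem DetailedBalance.inner_pow_mulVec (h : DetailedBalance P π) (m : ℕ) (f g : S → ℝ) :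
    weightedInner π (P ^ m *ᵥ f) g = weightedInner π f (P ^ m *ᵥ g) := by
  induction m generalizing f g with
  | zero => simp
  | succ m ih =>
    rw [pow_succ', ← mulVec_mulVec, h.inner_mulVec, ih, mulVec_mulVec, ← pow_succ, pow_succ']

theorem DetailedBalance.sum_mul_mulVec (h : DetailedBalance P π) (hP : P ∈ rowStochastic ℝ S)
    (f : S → ℝ) : ∑ x, π x * (P *ᵥ f) x = ∑ x, π x * f x := by
  have := h.inner_mulVec f 1
  rw [hP.2] at this
  simpa [weightedInner] using this

/-- Both `⟨f, (I - P) f⟩` and `⟨f, (I + P) f⟩` are sums of squares weighted by `π(x) P(x, y)`. -/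
theorem DetailedBalance.abs_inner_le (h : DetailedBalance P π) (hP : P ∈ rowStochastic ℝ S)
    (hπ : ∀ x, 0 ≤ π x) (f : S → ℝ) :
    |weightedInner π f (P *ᵥ f)| ≤ weightedInner π f f := by
  have e1 : weightedInner π f (P *ᵥ f) = ∑ x, ∑ y, π x * P x y * (f x * f y) := by
    simp only [weightedInner, mulVec, dotProduct, Finset.mul_sum]
    exact Finset.sum_congr rfl fun x _ => Finset.sum_congr rfl fun y _ => by ring
  have e2 : weightedInner π f f = ∑ x, ∑ y, π x * P x y * f x ^ 2 := by
    refine Finset.sum_congr rfl fun x _ => ?_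
    rw [← Finset.sum_mul, ← Finset.mul_sum, sum_row_of_mem_rowStochastic hP]
    ring
  have e3 : weightedInner π f f = ∑ x, ∑ y, π x * P x y * f y ^ 2 := by
    rw [e2, Finset.sum_comm]
    exact Finset.sum_congr rfl fun x _ => Finset.sum_congr rfl fun y _ => by rw [h]
  have hw : ∀ x y, 0 ≤ π x * P x y := fun x y => mul_nonneg (hπ x) (hP.1 x y)
  have p1 : 0 ≤ ∑ x, ∑ y, π x * P x y * (f x - f y) ^ 2 :=
    Finset.sum_nonneg fun x _ => Finset.sum_nonneg fun y _ => mul_nonneg (hw x y) (sq_nonneg _)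
  have p2 : 0 ≤ ∑ x, ∑ y, π x * P x y * (f x + f y) ^ 2 :=
    Finset.sum_nonneg fun x _ => Finset.sum_nonneg fun y _ => mul_nonneg (hw x y) (sq_nonneg _)
  have q1 : ∑ x, ∑ y, π x * P x y * (f x - f y) ^ 2 = (∑ x, ∑ y, π x * P x y * f x ^ 2)
      + (∑ x, ∑ y, π x * P x y * f y ^ 2) - 2 * ∑ x, ∑ y, π x * P x y * (f x * f y) := by
    simp only [Finset.mul_sum, ← Finset.sum_add_distrib, ← Finset.sum_sub_distrib]
    exact Finset.sum_congr rfl fun x _ => Finset.sum_congr rfl fun y _ => by ring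
  have q2 : ∑ x, ∑ y, π x * P x y * (f x + f y) ^ 2 = (∑ x, ∑ y, π x * P x y * f x ^ 2)
      + (∑ x, ∑ y, π x * P x y * f y ^ 2) + 2 * ∑ x, ∑ y, π x * P x y * (f x * f y) := by
    simp only [Finset.mul_sum, ← Finset.sum_add_distrib]
    exact Finset.sum_congr rfl fun x _ => Finset.sum_congr rfl fun y _ => by ring
  rw [q1, ← e1, ← e2, ← e3] at p1
  rw [q2, ← e1, ← e2, ← e3] at p2
  rw [abs_le]
  constructor <;> linarith

theorem DetailedBalance.inner_mulVec_self_le (h : DetailedBalance P π)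
    (hP : P ∈ rowStochastic ℝ S) (hπ : ∀ x, 0 ≤ π x) (f : S → ℝ) :
    weightedInner π (P *ᵥ f) (P *ᵥ f) ≤ weightedInner π f f := by
  rw [h.inner_mulVec, mulVec_mulVec, ← pow_two]
  have hd : DetailedBalance (P ^ 2) π := fun x y => by
    simp only [pow_two, Matrix.mul_apply, Finset.mul_sum]
    refine Finset.sum_congr rfl fun z _ => ?_
    linear_combination (P z y) * h x z + P z x * h z y
  exact (le_abs_self _).trans (hd.abs_inner_le (pow_mem hP 2) hπ f)

/-- Decay of the chain started at a state `a` with bounded mean hitting times. With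
`κ = 1_a / π(a) - 1`, the mean hitting time equation reads `h - P h = -c κ`, so the return
quantities `C_j = ⟨κ, P^j κ⟩` telescope:
`c ∑_{j < 2w} C_j = ⟨κ, P^(2w) h⟩ + π(h)`, where the first term is minus a Dirichlet form. Since
`C_j ≥ 0` and `C_{2j}` decreases, `w C_{2w} ≤ t / c`, and Cauchy-Schwarz concludes. -/
theorem DetailedBalance.mul_sq_pow_mulVec_le (h : DetailedBalance P π)
    (hP : P ∈ rowStochastic ℝ S) (hπ : ∀ x, 0 ≤ π x) (hπ1 : ∑ x, π x = 1)
    (hpsd : ∀ f : S → ℝ, 0 ≤ weightedInner π f (P *ᵥ f)) {a : S} (hπa : 0 < π a)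
    {H : S → ℝ} {c t : ℝ} (hc : 0 < c) (ha : H a = 0) (ht : ∀ x, H x ≤ t)
    (hH : ∀ x, x ≠ a → H x - (P *ᵥ H) x = c)
    {φ : S → ℝ} (hφ : ∀ x, |φ x| ≤ 1) (hφ0 : ∑ x, π x * φ x = 0) (w : ℕ) :
    w * (P ^ w *ᵥ φ) a ^ 2 ≤ t / c := by
  set κ : S → ℝ := fun x => (if x = a then (π a)⁻¹ else 0) - 1 with hκ
  have hκi : ∀ f : S → ℝ, weightedInner π κ f = f a - ∑ x, π x * f x := by
    intro f
    simp only [weightedInner, hκ, mul_sub, sub_mul, Finset.sum_sub_distrib, mul_one, mul_ite,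
      mul_zero, ite_mul, zero_mul]
    rw [Finset.sum_ite_eq' Finset.univ a, if_pos (Finset.mem_univ _), mul_inv_cancel₀ hπa.ne',
      one_mul]
  -- the hitting time equation at `a` itself follows from stationarity
  have hdrift : H - P *ᵥ H = (-c) • κ := by
    have hs : ∑ x, π x * (H x - (P *ᵥ H) x) = 0 := by
      simp only [mul_sub, Finset.sum_sub_distrib, h.sum_mul_mulVec hP, sub_self]
    have hs2 : ∑ x, π x * (H x - (P *ᵥ H) x) =
        π a * (H a - (P *ᵥ H) a - c) + ∑ x, π x * c := by
      have : ∀ x, π x * (H x - (P *ᵥ H) x) =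
          (if x = a then π a * (H a - (P *ᵥ H) a - c) else 0) + π x * c := by
        intro x
        split_ifs with hx
        · subst hx; ring
        · rw [hH x hx]; ring
      simp only [this, Finset.sum_add_distrib]
      simp
    rw [hs, ← Finset.sum_mul, hπ1] at hs2
    ext x
    simp only [Pi.sub_apply, Pi.smul_apply, smul_eq_mul, hκ]
    split_ifs with hx
    · subst hx
      field_simp
      linarith
    · rw [hH x hx]; ring
  set C : ℕ → ℝ := fun j => weightedInner π κ (P ^ j *ᵥ κ) with hC
  have htel : ∀ N : ℕ, c * ∑ j ∈ range N, C j =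
      weightedInner π κ (P ^ N *ᵥ H) - weightedInner π κ H := by
    intro N
    induction N with
    | zero => simp
    | succ N ih =>
      rw [sum_range_succ, mul_add, ih]
      have e : P ^ N *ᵥ H - P ^ (N + 1) *ᵥ H = (-c) • (P ^ N *ᵥ κ) := by
        rw [pow_succ, ← mulVec_mulVec, ← mulVec_sub, hdrift, mulVec_smul]
      have e2 : weightedInner π κ ((-c) • (P ^ N *ᵥ κ)) = -c * C N := by
        simp only [weightedInner, hC, Pi.smul_apply, smul_eq_mul, Finset.mul_sum]
        exact Finset.sum_congr rfl fun x _ => by ring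
      rw [← e, weightedInner_sub_right] at e2
      linarith
  have heven : ∀ j, C (2 * j) = weightedInner π (P ^ j *ᵥ κ) (P ^ j *ᵥ κ) := by
    intro j
    rw [h.inner_pow_mulVec, mulVec_mulVec, ← pow_add, ← two_mul]
  have hodd : ∀ j, 0 ≤ C (2 * j + 1) := by
    intro j
    have := hpsd (P ^ j *ᵥ κ)
    rwa [h.inner_pow_mulVec, mulVec_mulVec, mulVec_mulVec, ← pow_succ, ← pow_add,
      show j + 1 + j = 2 * j + 1 by ring] at this
  have hanti : Antitone fun j => C (2 * j) := by
    refine antitone_nat_of_succ_le fun j => ?_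
    rw [heven, heven, pow_succ', ← mulVec_mulVec]
    exact h.inner_mulVec_self_le hP hπ _
  have hsum : ∀ w : ℕ, w * C (2 * w) ≤ ∑ j ∈ range (2 * w), C j := by
    intro w
    have e : ∀ N : ℕ, ∑ j ∈ range N, C (2 * j) ≤ ∑ j ∈ range (2 * N), C j := by
      intro N
      induction N with
      | zero => simp
      | succ N ih =>
        rw [sum_range_succ, show 2 * (N + 1) = 2 * N + 1 + 1 by ring, sum_range_succ,
          sum_range_succ]
        linarith [hodd N]
    refine le_trans ?_ (e w)
    have : ∑ _j ∈ range w, C (2 * w) ≤ ∑ j ∈ range w, C (2 * j) :=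
      Finset.sum_le_sum fun j hj => hanti (mem_range.1 hj).le
    rwa [sum_const, card_range, nsmul_eq_mul] at this
  have hHle : ∑ x, π x * H x ≤ t := by
    calc ∑ x, π x * H x ≤ ∑ x, π x * t :=
          Finset.sum_le_sum fun x _ => mul_le_mul_of_nonneg_left (ht x) (hπ x)
      _ = t := by rw [← Finset.sum_mul, hπ1, one_mul]
  have hdir : weightedInner π κ (P ^ (2 * w) *ᵥ H) ≤ 0 := by
    have hD := (le_abs_self _).trans (h.abs_inner_le hP hπ (P ^ w *ᵥ H))
    have e : weightedInner π (H - P *ᵥ H) (P ^ (2 * w) *ᵥ H) =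
        weightedInner π (P ^ w *ᵥ H) (P ^ w *ᵥ H)
          - weightedInner π (P ^ w *ᵥ H) (P *ᵥ (P ^ w *ᵥ H)) := by
      rw [weightedInner_sub_left, h.inner_mulVec, h.inner_pow_mulVec, h.inner_pow_mulVec]
      simp only [mulVec_mulVec]
      rw [← pow_succ', ← pow_succ', ← pow_add, ← pow_add, two_mul,
        show w + w + 1 = w + (w + 1) by ring]
    have e2 : weightedInner π ((-c) • κ) (P ^ (2 * w) *ᵥ H)
        = -c * weightedInner π κ (P ^ (2 * w) *ᵥ H) := by
      simp only [weightedInner, Pi.smul_apply, smul_eq_mul, Finset.mul_sum]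
      exact Finset.sum_congr rfl fun x _ => by ring
    rw [← hdrift, e] at e2
    by_contra hpos
    push Not at hpos
    nlinarith
  have hC2 : w * C (2 * w) ≤ t / c := by
    rw [le_div_iff₀ hc]
    have h1 := htel (2 * w)
    rw [hκi H, ha] at h1
    have h2 := mul_le_mul_of_nonneg_left (hsum w) hc.le
    linarith
  have hval : (P ^ w *ᵥ φ) a = weightedInner π (P ^ w *ᵥ κ) φ := by
    rw [h.inner_pow_mulVec, hκi]
    have : ∀ m : ℕ, ∑ x, π x * (P ^ m *ᵥ φ) x = 0 := by
      intro m
      induction m with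
      | zero => simpa using hφ0
      | succ m ih =>
        rw [pow_succ', ← mulVec_mulVec, h.sum_mul_mulVec hP, ih]
    rw [this, sub_zero]
  have hφφ : weightedInner π φ φ ≤ 1 := by
    rw [← hπ1]
    refine Finset.sum_le_sum fun x _ => ?_
    have := abs_le.1 (hφ x)
    rw [mul_assoc]
    exact mul_le_of_le_one_right (hπ x) (by nlinarith)
  have hcs := weightedInner_sq_le hπ (P ^ w *ᵥ κ) φ
  rw [← heven] at hcs
  rw [hval]
  have hC0 : 0 ≤ C (2 * w) := by rw [heven]; exact weightedInner_self_nonneg hπ _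
  refine le_trans (mul_le_mul_of_nonneg_left (hcs.trans ?_) (Nat.cast_nonneg w)) hC2
  exact mul_le_of_le_one_right hC0 hφφ

end Reversible

/-! ### Lazy chains and irreducibility -/

section Lazy

variable {S : Type*} {K : Matrix S S ℝ} {π : S → ℝ} {δ : ℝ}

theorem DetailedBalance.lazyMatrix [DecidableEq S] (h : DetailedBalance K π) (δ : ℝ) :
    DetailedBalance (lazyMatrix K δ) π := by
  intro x y
  rcases eq_or_ne x y with rfl | hxy
  · rfl
  · simp only [_root_.lazyMatrix, Matrix.add_apply, Matrix.smul_apply, Matrix.one_apply_ne hxy,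
      Matrix.one_apply_ne hxy.symm, smul_eq_mul]
    linear_combination (1 - δ) * h x y

theorem IsStationaryDistribution.sum_mul_mulVec [Fintype S]
    (hπ : IsStationaryDistribution K π)
    (f : S → ℝ) : ∑ x, π x * (K *ᵥ f) x = ∑ x, π x * f x := by
  have := dotProduct_mulVec π K f
  rw [hπ.stationary] at this
  exact this

variable [Fintype S] [DecidableEq S]

theorem lazyMatrix_mulVec (K : Matrix S S ℝ) (δ : ℝ) (f : S → ℝ) (x : S) :
    (lazyMatrix K δ *ᵥ f) x = δ * f x + (1 - δ) * (K *ᵥ f) x := by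
  simp [lazyMatrix, add_mulVec, smul_mulVec]

theorem sub_lazyMatrix_mulVec (K : Matrix S S ℝ) (δ : ℝ) (f : S → ℝ) (x : S) :
    f x - (lazyMatrix K δ *ᵥ f) x = (1 - δ) * (f x - (K *ᵥ f) x) := by
  rw [lazyMatrix_mulVec]; ring

theorem lazyMatrix_mem_rowStochastic (hK : K ∈ rowStochastic ℝ S) (h0 : 0 ≤ δ) (h1 : δ ≤ 1) :
    lazyMatrix K δ ∈ rowStochastic ℝ S :=
  convex_rowStochastic (one_mem _) hK h0 (sub_nonneg.2 h1) (by ring)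

/-- A chain that holds with probability at least `1/2` has nonnegative spectrum. -/
theorem DetailedBalance.inner_lazyMatrix_nonneg (h : DetailedBalance K π)
    (hK : K ∈ rowStochastic ℝ S) (hπ : ∀ x, 0 ≤ π x) (hδ : 1 / 2 ≤ δ) (hδ1 : δ ≤ 1) (f : S → ℝ) :
    0 ≤ weightedInner π f (_root_.lazyMatrix K δ *ᵥ f) := by
  have e : weightedInner π f (_root_.lazyMatrix K δ *ᵥ f) =
      δ * weightedInner π f f + (1 - δ) * weightedInner π f (K *ᵥ f) := by
    simp only [weightedInner, lazyMatrix_mulVec, Finset.mul_sum, ← Finset.sum_add_distrib]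
    exact Finset.sum_congr rfl fun x _ => by ring
  have h1 := abs_le.1 (h.abs_inner_le hK hπ f)
  have h2 := weightedInner_self_nonneg hπ f
  have h3 := mul_le_mul_of_nonneg_left h1.1 (sub_nonneg.2 hδ1)
  have h4 : 0 ≤ (2 * δ - 1) * weightedInner π f f := mul_nonneg (by linarith) h2
  rw [e]
  linarith

/-- An irreducible matrix has a positive entry leading out of every proper nonempty set. -/
theorem Matrix.IsIrreducible.exists_exit (hK : K.IsIrreducible) {A : S → Prop} {i j : S}
    (hi : A i) (hj : ¬ A j) : ∃ k l, A k ∧ ¬ A l ∧ 0 < K k l := by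
  by_contra! hcon
  have hz : ∀ m k l, A k → ¬ A l → (K ^ m) k l = 0 := by
    intro m
    induction m with
    | zero =>
      intro k l hk hl
      exact Matrix.one_apply_ne fun h => hl (h ▸ hk)
    | succ m ih =>
      intro k l hk hl
      rw [pow_succ', Matrix.mul_apply]
      refine Finset.sum_eq_zero fun y _ => ?_
      by_cases hy : A y
      · rw [ih y l hy hl, mul_zero]
      · rw [le_antisymm (hcon k y hk hy) (hK.nonneg k y), zero_mul]
  obtain ⟨m, -, hm⟩ := (isIrreducible_iff_exists_pow_pos hK.nonneg).1 hK i j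
  exact hm.ne' (hz m i j hi hj)

theorem IsStationaryDistribution.pos (hπ : IsStationaryDistribution K π)
    (hK : K.IsIrreducible) (x : S) : 0 < π x := by
  by_contra hx
  obtain ⟨y, hy⟩ : ∃ y, 0 < π y := by
    by_contra! h
    have := Finset.sum_nonpos fun y (_ : y ∈ Finset.univ) => h y
    rw [hπ.sum_eq_one] at this
    linarith
  obtain ⟨k, l, hk, hl, hkl⟩ := hK.exists_exit (A := fun z => 0 < π z) hy hx
  have h1 : ∑ z, π z * K z l = π l := congrFun hπ.stationary l
  have h2 := Finset.single_le_sum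
    (fun z _ => mul_nonneg (hπ.nonneg z) (hK.nonneg z l)) (Finset.mem_univ k)
  exact hl (lt_of_lt_of_le (mul_pos hk hkl) (h2.trans_eq h1))

end Lazy

/-! ### Birth and death chains: reversibility and hitting times -/

namespace BirthDeathChain

variable {n : ℕ} (C : BirthDeathChain n)

theorem K_mem_rowStochastic : C.K ∈ rowStochastic ℝ (Fin (n + 1)) :=
  mem_rowStochastic_iff_sum.2 ⟨C.K_nonneg, C.K_row_sum⟩

/-- The generator `I - K` on the restriction to the state space of a function on `ℕ`. At `x = 0`
the value `F (x - 1)` is irrelevant because `q 0 = 0`. -/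
theorem sub_K_mulVec (F : ℕ → ℝ) (x : Fin (n + 1)) :
    F x - (C.K *ᵥ fun y => F y) x =
      C.p x * (F x - F (x + 1)) + C.q x * (F x - F (x - 1)) := by
  have e : ∀ y : Fin (n + 1), C.K x y * F y =
      (if (y : ℕ) = (x : ℕ) + 1 then C.p x else 0) * F (x + 1) +
      (if (x : ℕ) = (y : ℕ) + 1 then C.q x else 0) * F (x - 1) +
      (if y = x then C.r x else 0) * F x := by
    intro y
    simp only [K, Matrix.of_apply]
    rcases eq_or_ne y x with rfl | hyx
    · have h : ¬ (y : ℕ) = y + 1 := by omega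
      simp only [if_neg h, if_pos]
      ring
    · simp only [if_neg hyx]
      split_ifs with h1 h2 h2
      · omega
      · rw [h1]; ring
      · rw [h2, Nat.add_sub_cancel]; ring
      · ring
  simp only [mulVec, dotProduct, e, Finset.sum_add_distrib, ← Finset.sum_mul, C.sum_up, C.sum_down,
    Finset.sum_ite_eq', Finset.mem_univ, if_true]
  linear_combination -F x * (C.sum_eq_one x)

variable {C} {π : Fin (n + 1) → ℝ}

theorem p_pos (hK : C.K.IsIrreducible) {x y : Fin (n + 1)} (h : x < y) : 0 < C.p x := by
  obtain ⟨k, l, hk, hl, hkl⟩ := hK.exists_exit (A := fun z => z ≤ x) le_rfl h.not_ge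
  have hk' : (k : ℕ) ≤ x := hk
  have hl' : (x : ℕ) < l := not_le.1 hl
  simp only [K, Matrix.of_apply] at hkl
  split_ifs at hkl with h1 h2 h3
  · have : k = x := Fin.ext (by omega)
    rwa [← this]
  · omega
  · subst h3; omega
  · exact absurd hkl (lt_irrefl 0)

theorem q_pos (hK : C.K.IsIrreducible) {x y : Fin (n + 1)} (h : y < x) : 0 < C.q x := by
  obtain ⟨k, l, hk, hl, hkl⟩ := hK.exists_exit (A := fun z => x ≤ z) le_rfl h.not_ge
  have hk' : (x : ℕ) ≤ k := hk
  have hl' : (l : ℕ) < x := not_le.1 hl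
  simp only [K, Matrix.of_apply] at hkl
  split_ifs at hkl with h1 h2 h3
  · omega
  · have : k = x := Fin.ext (by omega)
    rwa [← this]
  · subst h3; omega
  · exact absurd hkl (lt_irrefl 0)

/-- In equilibrium the flow across the edge between `k` and `k + 1` vanishes: this is stationarity
tested against the indicator of `[0, k]`. -/
theorem edge_balance (hπ : IsStationaryDistribution C.K π) {k l : Fin (n + 1)}
    (h : (l : ℕ) = k + 1) : π k * C.p k = π l * C.q l := by
  set F : ℕ → ℝ := fun m => if m ≤ k then 1 else 0 with hF
  have hs : ∑ x : Fin (n + 1), π x * (F x - (C.K *ᵥ fun y => F y) x) = 0 := by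
    simp only [mul_sub, Finset.sum_sub_distrib, hπ.sum_mul_mulVec, sub_self]
  have e : ∀ x : Fin (n + 1), π x * (F x - (C.K *ᵥ fun y => F y) x) =
      (if x = k then π k * C.p k else 0) - (if x = l then π l * C.q l else 0) := by
    intro x
    rw [C.sub_K_mulVec]
    simp only [hF]
    rcases lt_trichotomy (x : ℕ) k with hx | hx | hx
    · rw [if_pos hx.le, if_pos (by omega), if_pos (by omega), if_neg (by omega), if_neg (by omega)]
      ring
    · have hxk : x = k := Fin.ext hx
      subst hxk
      rw [if_pos le_rfl, if_neg (by omega), if_pos (by omega), if_pos rfl, if_neg (by omega)]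
      ring
    · by_cases hxl : x = l
      · subst hxl
        rw [if_neg (by omega), if_neg (by omega), if_pos (by omega), if_neg (by omega), if_pos rfl]
        ring
      · rw [if_neg (by omega), if_neg (by omega), if_neg (by omega), if_neg (by omega),
          if_neg hxl]
        ring
  simp only [e, Finset.sum_sub_distrib, Finset.sum_ite_eq', Finset.mem_univ, if_true] at hs
  linarith

theorem detailedBalance (hπ : IsStationaryDistribution C.K π) : DetailedBalance C.K π := by
  intro x y
  simp only [K, Matrix.of_apply]
  split_ifs <;>
    first
    | omega
    | (subst_vars; omega)
    | exact edge_balance hπ ‹_›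
    | exact (edge_balance hπ ‹_›).symm
    | (subst_vars; rfl)
    | simp_all

/-- Mean hitting time of `i₀` from `m` when `m ≤ i₀`, and `0` when `m ≥ i₀`. It is defined on `ℕ`
so that neighbours `m ± 1` can be written without boundary cases. -/
noncomputable def hitFromLeft (C : BirthDeathChain n) (π : Fin (n + 1) → ℝ) (i₀ : Fin (n + 1))
    (m : ℕ) : ℝ :=
  ∑ k ∈ Iio i₀, if m ≤ k then (∑ j ∈ Iic k, π j) / (π k * C.p k) else 0

/-- Mean hitting time of `i₀` from `m` when `m ≥ i₀`, and `0` when `m ≤ i₀`. -/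
noncomputable def hitFromRight (C : BirthDeathChain n) (π : Fin (n + 1) → ℝ) (i₀ : Fin (n + 1))
    (m : ℕ) : ℝ :=
  ∑ k ∈ Ioi i₀, if (k : ℕ) ≤ m then (∑ j ∈ Ici k, π j) / (π k * C.q k) else 0

section Hit

variable {i₀ : Fin (n + 1)}

theorem hitFromLeft_nonneg (h0 : ∀ x, 0 ≤ π x) (m : ℕ) : 0 ≤ C.hitFromLeft π i₀ m :=
  Finset.sum_nonneg fun k _ => by
    split_ifs
    · exact div_nonneg (Finset.sum_nonneg fun j _ => h0 j) (mul_nonneg (h0 k) (C.p_nonneg k))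
    · exact le_rfl

theorem hitFromRight_nonneg (h0 : ∀ x, 0 ≤ π x) (m : ℕ) : 0 ≤ C.hitFromRight π i₀ m :=
  Finset.sum_nonneg fun k _ => by
    split_ifs
    · exact div_nonneg (Finset.sum_nonneg fun j _ => h0 j) (mul_nonneg (h0 k) (C.q_nonneg k))
    · exact le_rfl

theorem hitFromLeft_eq_zero {m : ℕ} (h : (i₀ : ℕ) ≤ m) : C.hitFromLeft π i₀ m = 0 :=
  Finset.sum_eq_zero fun k hk => by
    have : k < i₀ := Finset.mem_Iio.1 hk
    rw [if_neg (by omega)]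

theorem hitFromRight_eq_zero {m : ℕ} (h : m ≤ (i₀ : ℕ)) : C.hitFromRight π i₀ m = 0 :=
  Finset.sum_eq_zero fun k hk => by
    have : i₀ < k := Finset.mem_Ioi.1 hk
    rw [if_neg (by omega)]

theorem hitFromLeft_antitone (h0 : ∀ x, 0 ≤ π x) : Antitone (C.hitFromLeft π i₀) := by
  intro a b hab
  refine Finset.sum_le_sum fun k _ => ?_
  split_ifs
  · exact le_rfl
  · omega
  · exact div_nonneg (Finset.sum_nonneg fun j _ => h0 j) (mul_nonneg (h0 k) (C.p_nonneg k))
  · exact le_rfl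

theorem hitFromRight_monotone (h0 : ∀ x, 0 ≤ π x) : Monotone (C.hitFromRight π i₀) := by
  intro a b hab
  refine Finset.sum_le_sum fun k _ => ?_
  split_ifs
  · exact le_rfl
  · omega
  · exact div_nonneg (Finset.sum_nonneg fun j _ => h0 j) (mul_nonneg (h0 k) (C.q_nonneg k))
  · exact le_rfl

theorem hitFromLeft_sub (x : Fin (n + 1)) :
    C.hitFromLeft π i₀ x - C.hitFromLeft π i₀ (x + 1) =
      if x < i₀ then (∑ j ∈ Iic x, π j) / (π x * C.p x) else 0 := by
  have e := Finset.sum_ite_eq' (Iio i₀) x fun k => (∑ j ∈ Iic k, π j) / (π k * C.p k)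
  simp only [Finset.mem_Iio] at e
  rw [hitFromLeft, hitFromLeft, ← Finset.sum_sub_distrib, ← e]
  refine Finset.sum_congr rfl fun k _ => ?_
  by_cases hk : k = x
  · subst hk
    rw [if_pos le_rfl, if_neg (by omega), if_pos rfl, sub_zero]
  · rw [if_neg hk]
    have : (k : ℕ) ≠ x := fun h => hk (Fin.ext h)
    split_ifs <;> first | omega | ring

theorem hitFromRight_sub (x : Fin (n + 1)) (hx : (x : ℕ) ≠ 0) :
    C.hitFromRight π i₀ x - C.hitFromRight π i₀ (x - 1) =
      if i₀ < x then (∑ j ∈ Ici x, π j) / (π x * C.q x) else 0 := by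
  have e := Finset.sum_ite_eq' (Ioi i₀) x fun k => (∑ j ∈ Ici k, π j) / (π k * C.q k)
  simp only [Finset.mem_Ioi] at e
  rw [hitFromRight, hitFromRight, ← Finset.sum_sub_distrib, ← e]
  refine Finset.sum_congr rfl fun k _ => ?_
  by_cases hk : k = x
  · subst hk
    rw [if_pos le_rfl, if_neg (by omega), if_pos rfl, sub_zero]
  · rw [if_neg hk]
    have : (k : ℕ) ≠ x := fun h => hk (Fin.ext h)
    split_ifs <;> first | omega | ring

theorem p_mul_hitFromLeft_sub (hK : C.K.IsIrreducible)
    (hπ : IsStationaryDistribution C.K π) (x : Fin (n + 1)) :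
    C.p x * (C.hitFromLeft π i₀ x - C.hitFromLeft π i₀ (x + 1)) =
      if x < i₀ then (∑ j ∈ Iic x, π j) / π x else 0 := by
  rw [hitFromLeft_sub]
  split_ifs with h
  · have h1 := (p_pos hK h).ne'
    have h2 := (hπ.pos hK x).ne'
    field_simp
  · exact mul_zero _

theorem q_mul_hitFromLeft_sub (hK : C.K.IsIrreducible)
    (hπ : IsStationaryDistribution C.K π) (x : Fin (n + 1)) :
    C.q x * (C.hitFromLeft π i₀ x - C.hitFromLeft π i₀ (x - 1)) =
      if x ≤ i₀ then -((∑ j ∈ Iio x, π j) / π x) else 0 := by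
  by_cases hx : (x : ℕ) = 0
  · have hx0 : x = 0 := Fin.ext hx
    subst hx0
    have : (Iio (0 : Fin (n + 1))) = ∅ := by
      ext y; simp
    rw [this, C.q_zero]
    simp
  · obtain ⟨y, hy⟩ : ∃ y : Fin (n + 1), (x : ℕ) = y + 1 :=
      ⟨⟨x - 1, by omega⟩, by simp only; omega⟩
    have hI : Iio x = Iic y := by
      ext z
      simp only [Finset.mem_Iio, Finset.mem_Iic, Fin.lt_def, Fin.le_def]
      omega
    have hs := hitFromLeft_sub (C := C) (π := π) (i₀ := i₀) y
    have hiff : x ≤ i₀ ↔ y < i₀ := by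
      simp only [Fin.lt_def, Fin.le_def]
      omega
    rw [hI, show (x : ℕ) - 1 = y by omega, hy, ← neg_sub, hs]
    simp only [hiff]
    split_ifs with h
    · have h1 := (p_pos hK h).ne'
      have h2 := (hπ.pos hK y).ne'
      have h3 := (hπ.pos hK x).ne'
      rw [edge_balance hπ hy]
      have h4 := (q_pos hK (x := x) (y := y) (by rw [Fin.lt_def]; omega)).ne'
      field_simp
    · simp

theorem q_mul_hitFromRight_sub (hK : C.K.IsIrreducible)
    (hπ : IsStationaryDistribution C.K π) (x : Fin (n + 1)) :
    C.q x * (C.hitFromRight π i₀ x - C.hitFromRight π i₀ (x - 1)) =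
      if i₀ < x then (∑ j ∈ Ici x, π j) / π x else 0 := by
  by_cases hx : (x : ℕ) = 0
  · have hx0 : x = 0 := Fin.ext hx
    subst hx0
    rw [C.q_zero, if_neg (by rw [Fin.lt_def]; omega), zero_mul]
  rw [hitFromRight_sub x hx]
  split_ifs with h
  · have h1 := (q_pos hK h).ne'
    have h2 := (hπ.pos hK x).ne'
    field_simp
  · exact mul_zero _

theorem p_mul_hitFromRight_sub (hK : C.K.IsIrreducible)
    (hπ : IsStationaryDistribution C.K π) (x : Fin (n + 1)) :
    C.p x * (C.hitFromRight π i₀ x - C.hitFromRight π i₀ (x + 1)) =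
      if i₀ ≤ x then -((∑ j ∈ Ioi x, π j) / π x) else 0 := by
  by_cases hx : (x : ℕ) = n
  · have hx0 : x = Fin.last n := Fin.ext hx
    have : (Ioi x) = ∅ := by
      ext y
      simp only [Finset.mem_Ioi, Fin.lt_def, Finset.notMem_empty, iff_false]
      omega
    rw [this, hx0, C.p_last]
    simp
  · obtain ⟨y, hy⟩ : ∃ y : Fin (n + 1), (y : ℕ) = x + 1 := ⟨⟨x + 1, by omega⟩, rfl⟩
    have hI : Ioi x = Ici y := by
      ext z
      simp only [Finset.mem_Ioi, Finset.mem_Ici, Fin.lt_def, Fin.le_def]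
      omega
    have hs := hitFromRight_sub (C := C) (π := π) (i₀ := i₀) y (by omega)
    have hiff : i₀ ≤ x ↔ i₀ < y := by
      simp only [Fin.lt_def, Fin.le_def]
      omega
    rw [hy, Nat.add_sub_cancel] at hs
    rw [hI, ← neg_sub, hs]
    simp only [hiff]
    split_ifs with h
    · have h1 := (q_pos hK h).ne'
      have h2 := (hπ.pos hK y).ne'
      have h3 := (hπ.pos hK x).ne'
      rw [← edge_balance hπ hy]
      have h4 := (p_pos hK (x := x) (y := y) (by rw [Fin.lt_def]; omega)).ne'
      field_simp
    · simp

theorem hitFromLeft_drift_eq_one (hK : C.K.IsIrreducible)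
    (hπ : IsStationaryDistribution C.K π) {x : Fin (n + 1)} (hx : x < i₀) :
    C.hitFromLeft π i₀ x - (C.K *ᵥ fun y => C.hitFromLeft π i₀ y) x = 1 := by
  rw [C.sub_K_mulVec, p_mul_hitFromLeft_sub hK hπ, q_mul_hitFromLeft_sub hK hπ, if_pos hx,
    if_pos hx.le, ← Finset.Iio_insert, Finset.sum_insert (by simp)]
  have := (hπ.pos hK x).ne'
  field_simp
  ring

theorem hitFromLeft_drift_eq_zero (hK : C.K.IsIrreducible)
    (hπ : IsStationaryDistribution C.K π) {x : Fin (n + 1)} (hx : i₀ < x) :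
    C.hitFromLeft π i₀ x - (C.K *ᵥ fun y => C.hitFromLeft π i₀ y) x = 0 := by
  rw [C.sub_K_mulVec, p_mul_hitFromLeft_sub hK hπ, q_mul_hitFromLeft_sub hK hπ, if_neg hx.not_gt,
    if_neg hx.not_ge, add_zero]

theorem hitFromRight_drift_eq_one (hK : C.K.IsIrreducible)
    (hπ : IsStationaryDistribution C.K π) {x : Fin (n + 1)} (hx : i₀ < x) :
    C.hitFromRight π i₀ x - (C.K *ᵥ fun y => C.hitFromRight π i₀ y) x = 1 := by
  rw [C.sub_K_mulVec, p_mul_hitFromRight_sub hK hπ, q_mul_hitFromRight_sub hK hπ, if_pos hx,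
    if_pos hx.le, ← Finset.Ioi_insert, Finset.sum_insert (by simp)]
  have := (hπ.pos hK x).ne'
  field_simp
  ring

theorem hitFromRight_drift_eq_zero (hK : C.K.IsIrreducible)
    (hπ : IsStationaryDistribution C.K π) {x : Fin (n + 1)} (hx : x < i₀) :
    C.hitFromRight π i₀ x - (C.K *ᵥ fun y => C.hitFromRight π i₀ y) x = 0 := by
  rw [C.sub_K_mulVec, p_mul_hitFromRight_sub hK hπ, q_mul_hitFromRight_sub hK hπ,
    if_neg hx.not_gt, if_neg hx.not_ge, add_zero]

theorem hitFromLeft_drift_le (hK : C.K.IsIrreducible)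
    (hπ : IsStationaryDistribution C.K π) (x : Fin (n + 1)) :
    C.hitFromLeft π i₀ x - (C.K *ᵥ fun y => C.hitFromLeft π i₀ y) x ≤ 1 := by
  rcases lt_trichotomy x i₀ with hx | rfl | hx
  · exact (hitFromLeft_drift_eq_one hK hπ hx).le
  · have := nonneg_mulVec_of_mem_rowStochastic C.K_mem_rowStochastic
      (fun y : Fin (n + 1) => hitFromLeft_nonneg (C := C) (i₀ := x) hπ.nonneg y) x
    rw [hitFromLeft_eq_zero le_rfl]
    linarith
  · exact (hitFromLeft_drift_eq_zero hK hπ hx).trans_le zero_le_one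

theorem hitFromRight_drift_le (hK : C.K.IsIrreducible)
    (hπ : IsStationaryDistribution C.K π) (x : Fin (n + 1)) :
    C.hitFromRight π i₀ x - (C.K *ᵥ fun y => C.hitFromRight π i₀ y) x ≤ 1 := by
  rcases lt_trichotomy x i₀ with hx | rfl | hx
  · exact (hitFromRight_drift_eq_zero hK hπ hx).trans_le zero_le_one
  · have := nonneg_mulVec_of_mem_rowStochastic C.K_mem_rowStochastic
      (fun y : Fin (n + 1) => hitFromRight_nonneg (C := C) (i₀ := x) hπ.nonneg y) x
    rw [hitFromRight_eq_zero le_rfl]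
    linarith
  · exact (hitFromRight_drift_eq_one hK hπ hx).le

/-- The mean hitting time `𝔼_x τ_{i₀}` in closed form. -/
noncomputable def hitMean (C : BirthDeathChain n) (π : Fin (n + 1) → ℝ) (i₀ x : Fin (n + 1)) : ℝ :=
  C.hitFromLeft π i₀ x + C.hitFromRight π i₀ x

theorem hitMean_nonneg (h0 : ∀ x, 0 ≤ π x) (x : Fin (n + 1)) : 0 ≤ C.hitMean π i₀ x :=
  add_nonneg (hitFromLeft_nonneg h0 _) (hitFromRight_nonneg h0 _)

theorem hitMean_self : C.hitMean π i₀ i₀ = 0 := by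
  rw [hitMean, hitFromLeft_eq_zero le_rfl, hitFromRight_eq_zero le_rfl, add_zero]

theorem hitMean_zero : C.hitMean π i₀ 0 = C.hitFromLeft π i₀ 0 := by
  rw [hitMean, hitFromRight_eq_zero (by simp), add_zero]
  rfl

theorem hitMean_last : C.hitMean π i₀ (Fin.last n) = C.hitFromRight π i₀ n := by
  rw [hitMean, hitFromLeft_eq_zero (Fin.le_last i₀), zero_add]
  rfl

variable (C π i₀) in
theorem tMax_eq : C.tMax π i₀ = max (C.hitMean π i₀ 0) (C.hitMean π i₀ (Fin.last n)) := by
  rw [hitMean_zero, hitMean_last, tMax, hitFromLeft, hitFromRight]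
  have e : ∀ k : Fin (n + 1), (k : ℕ) ≤ n := fun k => Nat.le_of_lt_succ k.isLt
  simp only [Nat.zero_le, e, if_true]

theorem hitMean_le_tMax (h0 : ∀ x, 0 ≤ π x) (x : Fin (n + 1)) :
    C.hitMean π i₀ x ≤ C.tMax π i₀ := by
  rw [tMax_eq]
  rcases le_total (x : ℕ) i₀ with hx | hx
  · refine le_trans ?_ (le_max_left _ _)
    rw [hitMean_zero, hitMean, hitFromRight_eq_zero hx, add_zero]
    exact hitFromLeft_antitone h0 (Nat.zero_le _)
  · refine le_trans ?_ (le_max_right _ _)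
    rw [hitMean_last, hitMean, hitFromLeft_eq_zero hx, zero_add]
    exact hitFromRight_monotone h0 (Nat.le_of_lt_succ x.isLt)

theorem hitMean_drift (hK : C.K.IsIrreducible) (hπ : IsStationaryDistribution C.K π)
    {x : Fin (n + 1)} (hx : x ≠ i₀) :
    C.hitMean π i₀ x - (C.K *ᵥ C.hitMean π i₀) x = 1 := by
  have e : C.hitMean π i₀ =
      (fun y : Fin (n + 1) => C.hitFromLeft π i₀ y) + fun y : Fin (n + 1) => C.hitFromRight π i₀ y := rfl
  rw [e, mulVec_add, Pi.add_apply, Pi.add_apply]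
  rcases lt_or_gt_of_ne hx with h | h
  · linarith [hitFromLeft_drift_eq_one hK hπ h, hitFromRight_drift_eq_zero hK hπ h]
  · linarith [hitFromLeft_drift_eq_zero hK hπ h, hitFromRight_drift_eq_one hK hπ h]

/-- As soon as there is a state other than `i₀`, reaching `i₀` takes at least one step. -/
theorem one_le_tMax (hK : C.K.IsIrreducible) (hπ : IsStationaryDistribution C.K π) (hn : n ≠ 0) :
    1 ≤ C.tMax π i₀ := by
  obtain ⟨x, hx⟩ : ∃ x : Fin (n + 1), x ≠ i₀ := by
    have : Nontrivial (Fin (n + 1)) := Fin.nontrivial_iff_two_le.2 (by omega)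
    exact exists_ne i₀
  have h1 := hitMean_drift hK hπ hx
  have h2 := nonneg_mulVec_of_mem_rowStochastic C.K_mem_rowStochastic
    (hitMean_nonneg (C := C) (i₀ := i₀) hπ.nonneg) x
  linarith [hitMean_le_tMax (C := C) (i₀ := i₀) hπ.nonneg x]

end Hit

end BirthDeathChain

/-! ### Expected passage times on path space -/

theorem firstPassage_eq_tsum {S : Type*} [DecidableEq S] (j : S) (x : ℕ → S) :
    firstPassage j x = ∑' m : ℕ, if ∀ k ≤ m, x k ≠ j then (1 : ℝ≥0∞) else 0 := by
  by_cases h : ∃ m, x m = j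
  · have e : firstPassage j x = (Nat.find h : ℝ≥0∞) := by
      apply le_antisymm
      · exact iInf₂_le (f := fun (m : ℕ) (_ : x m = j) => (m : ℝ≥0∞)) _ (Nat.find_spec h)
      · exact le_iInf₂ fun m hm => Nat.cast_le.2 (Nat.find_min' h hm)
    have hiff : ∀ m, (∀ k ≤ m, x k ≠ j) ↔ m ∈ range (Nat.find h) := by
      intro m
      rw [Finset.mem_range, Nat.lt_find_iff]
    rw [e, tsum_eq_sum (s := range (Nat.find h)) fun m hm => if_neg ((hiff m).not.2 hm),
      Finset.sum_congr rfl fun m hm => if_pos ((hiff m).2 hm)]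
    simp
  · push Not at h
    have e : firstPassage j x = ⊤ := by
      simp [firstPassage, h]
    rw [e]
    simp only [h, ne_eq, not_false_eq_true, implies_true, if_true]
    exact (ENNReal.tsum_const_eq_top_of_ne_zero one_ne_zero).symm

namespace BirthDeathChain

open MeasureTheory ProbabilityTheory

variable {n : ℕ} (C : BirthDeathChain n)

theorem lintegral_stepPMF (i : Fin (n + 1)) (F : Fin (n + 1) → ℝ≥0∞) :
    ∫⁻ y, F y ∂(C.stepPMF i).toMeasure = ∑ y, ENNReal.ofReal (C.K i y) * F y := by
  rw [lintegral_fintype]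
  refine Finset.sum_congr rfl fun y _ => ?_
  rw [PMF.toMeasure_apply_singleton _ _ (measurableSet_singleton y), mul_comm]
  rfl

theorem lintegral_pathMeasure_zero (i : Fin (n + 1)) (F : Fin (n + 1) → ℝ≥0∞) :
    ∫⁻ x, F (x 0) ∂(C.pathMeasure i) = F i := by
  have hm := Kernel.traj_map_frestrictLe_apply (X := fun _ => Fin (n + 1)) (κ := C.stepKernel) 0 0 (fun _ => i)
  rw [Kernel.partialTraj_self, Kernel.id_apply] at hm
  have hF : Measurable fun y : (Π _ : Iic 0, Fin (n + 1)) => F (y ⟨0, mem_Iic.2 le_rfl⟩) :=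
    (measurable_of_countable F).comp (measurable_pi_apply _)
  have h1 := lintegral_map (μ := C.pathMeasure i) hF
    (Preorder.measurable_frestrictLe (X := fun _ => Fin (n + 1)) 0)
  have hm' : (C.pathMeasure i).map (Preorder.frestrictLe (π := fun _ => Fin (n + 1)) 0) =
      Measure.dirac fun _ => i := hm
  rw [hm', lintegral_dirac' _ hF] at h1
  exact h1.symm

/-- The Markov property at time `m`. -/
theorem lintegral_pathMeasure_succ (i : Fin (n + 1)) (m : ℕ)
    (f : (Π _ : Iic m, Fin (n + 1)) × Fin (n + 1) → ℝ≥0∞) :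
    ∫⁻ x, f (Preorder.frestrictLe m x, x (m + 1)) ∂(C.pathMeasure i) =
      ∫⁻ x, ∑ y, ENNReal.ofReal (C.K (x m) y) * f (Preorder.frestrictLe m x, y)
        ∂(C.pathMeasure i) := by
  have hf : Measurable f := measurable_of_countable f
  have h1 := Kernel.partialTraj_compProd_eq_map_traj (X := fun _ => Fin (n + 1)) (κ := C.stepKernel) (Nat.zero_le m)
    (x₀ := fun _ => i)
  have h2 := Kernel.traj_map_frestrictLe_apply (X := fun _ => Fin (n + 1)) (κ := C.stepKernel) 0 m (fun _ => i)
  have e1 := congrArg (fun μ => ∫⁻ z, f z ∂μ) h1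
  beta_reduce at e1
  rw [Measure.lintegral_compProd hf, lintegral_map hf (by fun_prop), ← h2,
    lintegral_map hf.lintegral_kernel_prod_right' (by fun_prop)] at e1
  refine e1.symm.trans (lintegral_congr fun x => ?_)
  exact C.lintegral_stepPMF (x m) fun y => f (Preorder.frestrictLe m x, y)

/-- The probability of avoiding `j` up to time `m + k`, by conditioning on the path up to time `m`.
For `k = 0` this identifies `survival` with the tail of the passage time. -/
theorem lintegral_survival (i j : Fin (n + 1)) (m k : ℕ) :
    ∫⁻ x, (if ∀ l ≤ m, x l ≠ j then ENNReal.ofReal (survival C.K j k (x m)) else 0)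
      ∂(C.pathMeasure i) = ENNReal.ofReal (survival C.K j (m + k) i) := by
  induction m generalizing k with
  | zero =>
    have := C.lintegral_pathMeasure_zero i
      fun y => if y ≠ j then ENNReal.ofReal (survival C.K j k y) else 0
    simp only [Nat.le_zero, forall_eq, zero_add]
    rw [this]
    split_ifs with h
    · rfl
    · push Not at h
      rw [h, survival_self, ENNReal.ofReal_zero]
  | succ m ih =>
    have := C.lintegral_pathMeasure_succ i m fun z =>
      if (∀ l : Iic m, z.1 l ≠ j) ∧ z.2 ≠ j then ENNReal.ofReal (survival C.K j k z.2) else 0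
    have hall : ∀ x : ℕ → Fin (n + 1), (∀ l : Iic m, Preorder.frestrictLe (π := fun _ => Fin (n + 1))
        m x l ≠ j) ↔ ∀ l ≤ m, x l ≠ j := by
      intro x
      simp [Preorder.frestrictLe]
    simp only [hall] at this
    rw [show m + 1 + k = m + (k + 1) by ring, ← ih (k + 1)]
    refine Eq.trans (lintegral_congr fun x => ?_) (this.trans (lintegral_congr fun x => ?_))
    · have : (∀ l ≤ m + 1, x l ≠ j) ↔ (∀ l ≤ m, x l ≠ j) ∧ x (m + 1) ≠ j := by
        constructor
        · exact fun h => ⟨fun l hl => h l (by omega), h _ le_rfl⟩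
        · rintro ⟨h1, h2⟩ l hl
          rcases Nat.le_succ_iff.1 hl with hl | rfl
          · exact h1 l hl
          · exact h2
      simp only [this]
    · by_cases h : ∀ l ≤ m, x l ≠ j
      · rw [if_pos h]
        have hs : survival C.K j (k + 1) (x m) = (C.K *ᵥ survival C.K j k) (x m) := by
          simp only [survival, if_neg (h m le_rfl)]
        rw [hs, mulVec, dotProduct, ENNReal.ofReal_sum_of_nonneg fun y _ =>
          mul_nonneg (C.K_nonneg _ y) (survival_nonneg C.K_mem_rowStochastic j k y)]
        refine Finset.sum_congr rfl fun y _ => ?_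
        rw [ENNReal.ofReal_mul (C.K_nonneg _ y)]
        by_cases hy : y = j
        · simp [hy, survival_self]
        · rw [if_pos ⟨h, hy⟩]
      · simp [h]

theorem meanPassage_eq_tsum (i j : Fin (n + 1)) :
    C.meanPassage i j = ∑' m : ℕ, ENNReal.ofReal (survival C.K j m i) := by
  simp only [meanPassage, firstPassage_eq_tsum]
  rw [lintegral_tsum]
  · refine tsum_congr fun m => ?_
    rw [← add_zero m, ← C.lintegral_survival i j m 0, add_zero]
    refine lintegral_congr fun x => ?_
    split_ifs with h
    · simp [survival, h m le_rfl]
    · rfl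
  · intro m
    refine (Measurable.ite ?_ measurable_const measurable_const).aemeasurable
    have : {x : ℕ → Fin (n + 1) | ∀ k ≤ m, x k ≠ j} = ⋂ k, ⋂ (_ : k ≤ m), {x | x k = j}ᶜ := by
      ext x; simp
    rw [this]
    exact MeasurableSet.iInter fun k => MeasurableSet.iInter fun _ =>
      (measurableSet_eq_fun (measurable_pi_apply k) measurable_const).compl

theorem meanPassage_eq {C : BirthDeathChain n} {π : Fin (n + 1) → ℝ} (hK : C.K.IsIrreducible)
    (hπ : IsStationaryDistribution C.K π) (i i₀ : Fin (n + 1)) :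
    C.meanPassage i i₀ = ENNReal.ofReal (C.hitMean π i₀ i) := by
  have hs := hasSum_survival C.K_mem_rowStochastic (hitMean_self (C := C) (π := π) (i₀ := i₀))
    (hitMean_nonneg hπ.nonneg) (hitMean_le_tMax hπ.nonneg) (fun x hx => hitMean_drift hK hπ hx) i
  rw [meanPassage_eq_tsum, ← hs.tsum_eq, ENNReal.ofReal_tsum_of_nonneg
    (fun m => survival_nonneg C.K_mem_rowStochastic i₀ m i) hs.summable]

end BirthDeathChain

/-! ### The continuous time chain as a limit of lazy chains -/

section Exp

open Filter Topology

theorem norm_pow_sub_pow_le {A : Type*} [NormedRing A] [NormOneClass A] {a b : A} {M : ℝ}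
    (hM : 1 ≤ M) (ha : ‖a‖ ≤ M) (hb : ‖b‖ ≤ M) (m : ℕ) :
    ‖a ^ m - b ^ m‖ ≤ m * M ^ m * ‖a - b‖ := by
  induction m with
  | zero => simp
  | succ m ih =>
    have e : a ^ (m + 1) - b ^ (m + 1) = a ^ m * (a - b) + (a ^ m - b ^ m) * b := by
      rw [pow_succ, pow_succ]; noncomm_ring
    have h1 : ‖a ^ m‖ ≤ M ^ m := (norm_pow_le a m).trans (pow_le_pow_left₀ (norm_nonneg a) ha m)
    have hMm : M ^ m ≤ M ^ (m + 1) := pow_le_pow_right₀ hM (Nat.le_succ m)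
    calc ‖a ^ (m + 1) - b ^ (m + 1)‖ ≤ ‖a ^ m‖ * ‖a - b‖ + ‖a ^ m - b ^ m‖ * ‖b‖ := by
          rw [e]
          exact (norm_add_le _ _).trans (add_le_add (norm_mul_le _ _) (norm_mul_le _ _))
      _ ≤ M ^ (m + 1) * ‖a - b‖ + m * M ^ m * ‖a - b‖ * M := by
          gcongr
          exact h1.trans hMm
      _ = ((m + 1 : ℕ) : ℝ) * M ^ (m + 1) * ‖a - b‖ := by push_cast; ring

theorem NormedSpace.tendsto_one_add_smul_pow_exp {A : Type*} [NormedRing A] [NormOneClass A]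
    [NormedAlgebra ℝ A] [CompleteSpace A] (B : A) :
    Tendsto (fun m : ℕ => (1 + (m : ℝ)⁻¹ • B) ^ m) atTop (𝓝 (NormedSpace.exp B)) := by
  let : NormedAlgebra ℚ A := NormedAlgebra.restrictScalars ℚ ℝ A
  -- `exp (B / m) = 1 + B / m + o(1 / m)`
  have hd : HasDerivAt (fun u : ℝ => NormedSpace.exp (u • B)) B 0 := by
    simpa using hasDerivAt_exp_smul_const B (0 : ℝ)
  have ho := hd.tendsto_slope_zero
  simp only [zero_add, zero_smul, NormedSpace.exp_zero] at ho
  have hinv : Tendsto (fun m : ℕ => ((m : ℝ))⁻¹) atTop (𝓝[≠] 0) :=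
    tendsto_nhdsWithin_iff.2 ⟨tendsto_inv_atTop_nhds_zero_nat, eventually_atTop.2 ⟨1, fun m hm =>
      inv_ne_zero (Nat.cast_ne_zero.2 (by omega))⟩⟩
  have hslope := ho.comp hinv
  set r : ℕ → ℝ := fun m => ‖(m : ℝ) • (NormedSpace.exp ((m : ℝ)⁻¹ • B) - 1) - B‖ with hr
  have hr0 : Tendsto r atTop (𝓝 0) := by
    have := tendsto_iff_norm_sub_tendsto_zero.1 hslope
    refine this.congr fun m => ?_
    simp [hr]
  rw [tendsto_iff_norm_sub_tendsto_zero]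
  have hlim : Tendsto (fun m => Real.exp (‖B‖ + 1) * r m) atTop (𝓝 0) := by
    simpa using hr0.const_mul (Real.exp (‖B‖ + 1))
  refine squeeze_zero' (Eventually.of_forall fun _ => norm_nonneg _) ?_ hlim
  filter_upwards [eventually_ge_atTop 1, hr0.eventually_le_const one_pos] with m hm hrm
  have hm0 : (0 : ℝ) < m := Nat.cast_pos.2 hm
  set a := NormedSpace.exp ((m : ℝ)⁻¹ • B) with ha
  have hpow : NormedSpace.exp B = a ^ m := by
    rw [ha, ← NormedSpace.exp_nsmul, ← Nat.cast_smul_eq_nsmul ℝ, smul_smul,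
      mul_inv_cancel₀ hm0.ne', one_smul]
  have hdiff : ‖a - (1 + (m : ℝ)⁻¹ • B)‖ = (m : ℝ)⁻¹ * r m := by
    have : a - (1 + (m : ℝ)⁻¹ • B) = (m : ℝ)⁻¹ • ((m : ℝ) • (a - 1) - B) := by
      rw [smul_sub, smul_smul, inv_mul_cancel₀ hm0.ne', one_smul]; abel
    rw [this, norm_smul, Real.norm_of_nonneg (inv_nonneg.2 hm0.le)]
  set M : ℝ := 1 + (m : ℝ)⁻¹ * (‖B‖ + 1) with hM
  have hinv0 : (0 : ℝ) ≤ (m : ℝ)⁻¹ := inv_nonneg.2 hm0.le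
  have hb' : ‖1 + (m : ℝ)⁻¹ • B‖ ≤ 1 + (m : ℝ)⁻¹ * ‖B‖ := by
    refine (norm_add_le _ _).trans_eq ?_
    rw [norm_one, norm_smul, Real.norm_of_nonneg hinv0]
  have hb : ‖1 + (m : ℝ)⁻¹ • B‖ ≤ M := by
    rw [hM]; linarith
  have haM : ‖a‖ ≤ M := by
    have h1 : ‖a‖ ≤ ‖a - (1 + (m : ℝ)⁻¹ • B)‖ + ‖1 + (m : ℝ)⁻¹ • B‖ := by
      simpa using norm_add_le (a - (1 + (m : ℝ)⁻¹ • B)) (1 + (m : ℝ)⁻¹ • B)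
    rw [hdiff] at h1
    have h2 : (m : ℝ)⁻¹ * r m ≤ (m : ℝ)⁻¹ * 1 := mul_le_mul_of_nonneg_left hrm hinv0
    rw [hM]
    linarith
  have hM1 : 1 ≤ M := by
    have : 0 ≤ (m : ℝ)⁻¹ * (‖B‖ + 1) := by positivity
    rw [hM]; linarith
  have hMm : M ^ m ≤ Real.exp (‖B‖ + 1) := by
    calc M ^ m ≤ Real.exp ((m : ℝ)⁻¹ * (‖B‖ + 1)) ^ m := by
          refine pow_le_pow_left₀ (by linarith) ?_ m
          rw [hM, add_comm]
          exact Real.add_one_le_exp _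
      _ = Real.exp (‖B‖ + 1) := by
          rw [← Real.exp_nat_mul, ← mul_assoc, mul_inv_cancel₀ hm0.ne', one_mul]
  rw [hpow, norm_sub_rev]
  refine (norm_pow_sub_pow_le hM1 haM hb m).trans ?_
  rw [hdiff, show (m : ℝ) * M ^ m * ((m : ℝ)⁻¹ * r m) = ((m : ℝ) * (m : ℝ)⁻¹) * (M ^ m * r m) by
    ring, mul_inv_cancel₀ hm0.ne', one_mul]
  exact mul_le_mul_of_nonneg_right hMm (norm_nonneg _)

theorem tendsto_lazyMatrix_pow_heatSemigroup {S : Type*} [Fintype S] [DecidableEq S] [Nonempty S]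
    (K : Matrix S S ℝ) (s : ℝ) :
    Tendsto (fun m : ℕ => lazyMatrix K (1 - s / m) ^ m) atTop (𝓝 (heatSemigroup K s)) := by
  let : NormedRing (Matrix S S ℝ) := Matrix.linftyOpNormedRing
  let : NormedAlgebra ℝ (Matrix S S ℝ) := Matrix.linftyOpNormedAlgebra
  have : NormOneClass (Matrix S S ℝ) := Matrix.linfty_opNormOneClass
  refine (NormedSpace.tendsto_one_add_smul_pow_exp (-(s • (1 - K)))).congr fun m => ?_
  congr 1
  ext x y
  simp only [lazyMatrix, Matrix.add_apply, Matrix.smul_apply, Matrix.neg_apply, Matrix.sub_apply,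
    smul_eq_mul]
  ring

end Exp

/-! ### Total variation and mixing times -/

section TotalVariation

variable {S : Type*} [Finite S]

theorem sum_sub_sum_le_tvDist (μ ν : S → ℝ) (A : Finset S) :
    ∑ i ∈ A, μ i - ∑ i ∈ A, ν i ≤ tvDist μ ν :=
  le_ciSup (f := fun A : Finset S => ∑ i ∈ A, μ i - ∑ i ∈ A, ν i) (Set.finite_range _).bddAbove A

theorem maxTVDist_le_iff [Nonempty S] {P : Matrix S S ℝ} {π : S → ℝ} {η : ℝ} :
    maxTVDist P π ≤ η ↔ ∀ x (A : Finset S), ∑ i ∈ A, P x i - ∑ i ∈ A, π i ≤ η := by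
  constructor
  · intro h x A
    exact (sum_sub_sum_le_tvDist _ _ A).trans
      ((le_ciSup (f := fun x => tvDist (P x) π) (Set.finite_range _).bddAbove x).trans h)
  · exact fun h => ciSup_le fun x => ciSup_le fun A => h x A

end TotalVariation

namespace BirthDeathChain

open Filter Topology

variable {n : ℕ} {C : BirthDeathChain n} {π : Fin (n + 1) → ℝ} {i₀ : Fin (n + 1)}

/-! ### Lower bounds -/

/-- If `Q` decreases `g` by at most `s`, where `g` is maximal at `x` and supported on a set of
stationary mass at most `1/2`, then total variation distance at most `η` forces
`g x (1/2 - η) ≤ s`. -/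
theorem mul_half_sub_le {Q : Matrix (Fin (n + 1)) (Fin (n + 1)) ℝ} (hQ : ∀ x y, 0 ≤ Q x y)
    {η s : ℝ} (hη : maxTVDist Q π ≤ η) {g : Fin (n + 1) → ℝ} {x : Fin (n + 1)}
    (hg0 : 0 ≤ g x) (hgx : ∀ y, g y ≤ g x) {A : Finset (Fin (n + 1))} (hgA : ∀ y ∉ A, g y = 0)
    (hA : ∑ y ∈ A, π y ≤ 1 / 2) (hs : g x - (Q *ᵥ g) x ≤ s) : g x * (1 / 2 - η) ≤ s := by
  have h1 := maxTVDist_le_iff.1 hη x A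
  have h2 : (Q *ᵥ g) x ≤ (∑ y ∈ A, Q x y) * g x := by
    rw [mulVec, dotProduct, Finset.sum_mul,
      ← Finset.sum_subset (Finset.subset_univ A) fun y _ hy => by rw [hgA y hy, mul_zero]]
    exact Finset.sum_le_sum fun y _ => mul_le_mul_of_nonneg_left (hgx y) (hQ x y)
  have h3 : (∑ y ∈ A, Q x y) * g x ≤ (1 / 2 + η) * g x :=
    mul_le_mul_of_nonneg_right (by linarith) hg0
  linarith

/-- Deterministic form of the lower bounds, common to both time scales: `s` bounds the decrease under
`Q` of every function whose drift under `K` is at least `-1`. -/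
theorem tMax_mul_le (hK : C.K.IsIrreducible) (hπ : IsStationaryDistribution C.K π)
    (hleft : 1 / 2 ≤ ∑ i ∈ Iic i₀, π i) (hright : 1 / 2 ≤ ∑ i ∈ Ici i₀, π i)
    {Q : Matrix (Fin (n + 1)) (Fin (n + 1)) ℝ} (hQ : ∀ x y, 0 ≤ Q x y) {η s : ℝ}
    (hη : maxTVDist Q π ≤ η) (hs : ∀ g : Fin (n + 1) → ℝ, (∀ x, g x - (C.K *ᵥ g) x ≤ 1) →
      ∀ x, g x - (Q *ᵥ g) x ≤ s) : C.tMax π i₀ * (1 / 2 - η) ≤ s := by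
  have hIio : ∑ y ∈ Iio i₀, π y ≤ 1 / 2 := by
    have hd : Disjoint (Iio i₀) (Ici i₀) := Finset.disjoint_left.2 fun y hy hy' =>
      absurd (Finset.mem_Ici.1 hy') (Finset.mem_Iio.1 hy).not_ge
    have := Finset.sum_le_sum_of_subset_of_nonneg (Finset.subset_univ (Iio i₀ ∪ Ici i₀))
      fun y _ _ => hπ.nonneg y
    rw [Finset.sum_union hd, hπ.sum_eq_one] at this
    linarith
  have hIoi : ∑ y ∈ Ioi i₀, π y ≤ 1 / 2 := by
    have hd : Disjoint (Ioi i₀) (Iic i₀) := Finset.disjoint_left.2 fun y hy hy' =>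
      absurd (Finset.mem_Iic.1 hy') (Finset.mem_Ioi.1 hy).not_ge
    have := Finset.sum_le_sum_of_subset_of_nonneg (Finset.subset_univ (Ioi i₀ ∪ Iic i₀))
      fun y _ _ => hπ.nonneg y
    rw [Finset.sum_union hd, hπ.sum_eq_one] at this
    linarith
  have hL : C.hitMean π i₀ 0 * (1 / 2 - η) ≤ s := by
    rw [hitMean_zero]
    refine mul_half_sub_le hQ hη (g := fun y => C.hitFromLeft π i₀ y) (x := 0)
      (hitFromLeft_nonneg hπ.nonneg _)
      (fun y => hitFromLeft_antitone hπ.nonneg (Nat.zero_le _)) (fun y hy => ?_) hIio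
      (hs _ (hitFromLeft_drift_le hK hπ) 0)
    exact hitFromLeft_eq_zero (not_lt.1 fun h => hy (Finset.mem_Iio.2 h))
  have hR : C.hitMean π i₀ (Fin.last n) * (1 / 2 - η) ≤ s := by
    rw [hitMean_last]
    refine mul_half_sub_le hQ hη (g := fun y => C.hitFromRight π i₀ y) (x := Fin.last n)
      (hitFromRight_nonneg hπ.nonneg _)
      (fun y => hitFromRight_monotone hπ.nonneg (Nat.le_of_lt_succ y.isLt)) (fun y hy => ?_) hIoi
      (hs _ (hitFromRight_drift_le hK hπ) (Fin.last n))
    exact hitFromRight_eq_zero (not_lt.1 fun h => hy (Finset.mem_Ioi.2 h))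
  rw [tMax_eq]
  rcases max_choice (C.hitMean π i₀ 0) (C.hitMean π i₀ (Fin.last n)) with h | h <;> rw [h] <;>
    assumption

theorem sub_lazyMatrix_pow_mulVec_le {δ : ℝ} (h0 : 0 ≤ δ) (h1 : δ ≤ 1) {g : Fin (n + 1) → ℝ}
    (hg : ∀ x, g x - (C.K *ᵥ g) x ≤ 1) (m : ℕ) (x : Fin (n + 1)) :
    g x - (lazyMatrix C.K δ ^ m *ᵥ g) x ≤ m * (1 - δ) := by
  refine sub_pow_mulVec_le (lazyMatrix_mem_rowStochastic C.K_mem_rowStochastic h0 h1)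
    (fun y => ?_) m x
  rw [sub_lazyMatrix_mulVec]
  exact mul_le_of_le_one_right (sub_nonneg.2 h1) (hg y)

theorem tMax_le_of_lazy (hK : C.K.IsIrreducible) (hπ : IsStationaryDistribution C.K π)
    (hleft : 1 / 2 ≤ ∑ i ∈ Iic i₀, π i) (hright : 1 / 2 ≤ ∑ i ∈ Ici i₀, π i)
    {δ : ℝ} (h0 : 0 ≤ δ) (h1 : δ ≤ 1) {η : ℝ} {m : ℕ}
    (h : maxTVDist (lazyMatrix C.K δ ^ m) π ≤ η) :
    C.tMax π i₀ * (1 / 2 - η) ≤ m * (1 - δ) :=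
  tMax_mul_le hK hπ hleft hright
    (pow_mem (lazyMatrix_mem_rowStochastic C.K_mem_rowStochastic h0 h1) m).1 h
    fun _ hg => sub_lazyMatrix_pow_mulVec_le h0 h1 hg m

/-- `K_{1 - s/m}` is a transition matrix as soon as `m` is large. -/
theorem eventually_lazy_param {s : ℝ} (hs : 0 ≤ s) :
    ∀ᶠ m : ℕ in atTop, 0 < m ∧ 1 / 2 ≤ 1 - s / m ∧ 1 - s / (m : ℝ) ≤ 1 := by
  obtain ⟨N, hN⟩ := exists_nat_ge (2 * s)
  filter_upwards [eventually_ge_atTop (N + 1)] with m hm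
  have hm0 : 0 < m := by omega
  have hm0' : (0 : ℝ) < m := Nat.cast_pos.2 hm0
  have hNm : (N : ℝ) ≤ m := Nat.cast_le.2 (by omega)
  refine ⟨hm0, ?_, ?_⟩
  · have : s / m ≤ 1 / 2 := by
      rw [div_le_iff₀ hm0']; linarith
    linarith
  · have := div_nonneg hs hm0'.le
    linarith

theorem tendsto_lazyMatrix_pow_apply (K : Matrix (Fin (n + 1)) (Fin (n + 1)) ℝ) (s : ℝ)
    (x y : Fin (n + 1)) :
    Tendsto (fun m : ℕ => (lazyMatrix K (1 - s / m) ^ m) x y) atTop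
      (𝓝 (heatSemigroup K s x y)) :=
  tendsto_pi_nhds.1 (tendsto_pi_nhds.1 (tendsto_lazyMatrix_pow_heatSemigroup K s) x) y

theorem tMax_le_of_heat (hK : C.K.IsIrreducible) (hπ : IsStationaryDistribution C.K π)
    (hleft : 1 / 2 ≤ ∑ i ∈ Iic i₀, π i) (hright : 1 / 2 ≤ ∑ i ∈ Ici i₀, π i)
    {s : ℝ} (hs : 0 ≤ s) {η : ℝ} (h : maxTVDist (heatSemigroup C.K s) π ≤ η) :
    C.tMax π i₀ * (1 / 2 - η) ≤ s := by
  refine tMax_mul_le hK hπ hleft hright (fun x y => ?_) h fun g hg x => ?_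
  · refine ge_of_tendsto (tendsto_lazyMatrix_pow_apply C.K s x y) ?_
    filter_upwards [eventually_lazy_param hs] with m hm
    exact (pow_mem (lazyMatrix_mem_rowStochastic C.K_mem_rowStochastic (by linarith [hm.2.1])
      hm.2.2) m).1 x y
  · have ht : Tendsto (fun m : ℕ => g x - (lazyMatrix C.K (1 - s / m) ^ m *ᵥ g) x) atTop
        (𝓝 (g x - (heatSemigroup C.K s *ᵥ g) x)) := by
      simp only [mulVec, dotProduct]
      exact tendsto_const_nhds.sub (tendsto_finsetSum _ fun y _ =>
        (tendsto_lazyMatrix_pow_apply C.K s x y).mul_const _)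
    refine le_of_tendsto ht ?_
    filter_upwards [eventually_lazy_param hs] with m hm
    have := sub_lazyMatrix_pow_mulVec_le (by linarith [hm.2.1]) hm.2.2 hg m x
    have hm0 : (m : ℝ) ≠ 0 := Nat.cast_ne_zero.2 hm.1.ne'
    rwa [sub_sub_cancel, mul_div_cancel₀ _ hm0] at this

/-! ### Upper bounds -/

/-- After a time `m` with `(1 - δ) m ≥ 8 t / ε²` the lazy chain is `ε`-mixed: about
`3 t / ((1 - δ) ε²)` steps make it unlikely that `i₀` has not been visited, and the remaining steps
mix the chain started at `i₀`. -/
theorem maxTVDist_lazyMatrix_pow_le (hK : C.K.IsIrreducible)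
    (hπ : IsStationaryDistribution C.K π) (hn : n ≠ 0) {δ : ℝ} (hδ : 1 / 2 ≤ δ) (hδ1 : δ < 1)
    {ε : ℝ} (hε : 0 < ε) (hε1 : ε < 1) {m : ℕ}
    (hm : 8 * C.tMax π i₀ / ε ^ 2 ≤ m * (1 - δ)) :
    maxTVDist (lazyMatrix C.K δ ^ m) π ≤ ε := by
  set t := C.tMax π i₀ with ht
  set P := lazyMatrix C.K δ with hPdef
  have ht1 : 1 ≤ t := one_le_tMax hK hπ hn
  have hc : 0 < 1 - δ := by linarith
  have hε2 : 0 < ε ^ 2 := by positivity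
  have hε21 : ε ^ 2 ≤ 1 := by nlinarith
  set T := t / ε ^ 2 with hT
  have hT1 : 1 ≤ T := by rw [hT, le_div_iff₀ hε2]; linarith
  have hTε : T * ε ^ 2 = t := div_mul_cancel₀ _ hε2.ne'
  have hm' : 8 * T / (1 - δ) ≤ m := by
    rw [div_le_iff₀ hc, hT, ← mul_div_assoc]; exact hm
  have hP : P ∈ rowStochastic ℝ (Fin (n + 1)) :=
    lazyMatrix_mem_rowStochastic C.K_mem_rowStochastic (by linarith) hδ1.le
  have hdb : DetailedBalance P π := (detailedBalance hπ).lazyMatrix δ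
  have hdrift : ∀ x, x ≠ i₀ → C.hitMean π i₀ x - (P *ᵥ C.hitMean π i₀) x = 1 - δ := by
    intro x hx
    rw [hPdef, sub_lazyMatrix_mulVec, hitMean_drift hK hπ hx, mul_one]
  -- the lazy chain needs `1 / (1 - δ)` times as long to hit `i₀`
  set H : Fin (n + 1) → ℝ := (1 - δ)⁻¹ • C.hitMean π i₀ with hH
  have hHle : ∀ x, H x ≤ t / (1 - δ) := by
    intro x
    rw [div_eq_inv_mul]
    exact mul_le_mul_of_nonneg_left (hitMean_le_tMax hπ.nonneg x) (inv_nonneg.2 hc.le)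
  have hsurv : ∀ (u : ℕ) (x : Fin (n + 1)), u * survival P i₀ u x ≤ t / (1 - δ) := by
    intro u x
    refine (mul_survival_le hP (H := H) ?_ (fun y => ?_) hHle (fun y hy => ?_) u x).trans (hHle x)
    · simp [hH, hitMean_self]
    · exact mul_nonneg (inv_nonneg.2 hc.le) (hitMean_nonneg hπ.nonneg y)
    · rw [hH, mulVec_smul]
      simp only [Pi.smul_apply, smul_eq_mul]
      rw [← mul_sub, hdrift y hy, inv_mul_cancel₀ hc.ne']
  -- split `m = v + u`
  set u : ℕ := ⌈3 * T / (1 - δ)⌉₊ with hu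
  have hTc : 1 ≤ T / (1 - δ) := by rw [le_div_iff₀ hc]; linarith
  have e3 : 3 * T / (1 - δ) = 3 * (T / (1 - δ)) := by ring
  have e8 : 8 * T / (1 - δ) = 8 * (T / (1 - δ)) := by ring
  have hu1 : 3 * (T / (1 - δ)) ≤ u := by rw [← e3]; exact Nat.le_ceil _
  have hu2 : (u : ℝ) < 3 * (T / (1 - δ)) + 1 := by
    rw [← e3]; exact Nat.ceil_lt_add_one (by rw [e3]; linarith)
  rw [e8] at hm'
  have hum : u ≤ m := by
    have : (u : ℝ) ≤ m := by linarith
    exact_mod_cast this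
  obtain ⟨v, rfl⟩ : ∃ v, m = v + u := ⟨m - u, by omega⟩
  push_cast at hm'
  have hv : 4 * (T / (1 - δ)) ≤ v := by linarith
  have htc : t / (1 - δ) = T / (1 - δ) * ε ^ 2 := by rw [← hTε]; ring
  have hTc0 : 0 < T / (1 - δ) := by linarith
  rw [maxTVDist_le_iff]
  intro x A
  set φ : Fin (n + 1) → ℝ := (fun y => if y ∈ A then 1 else 0) - fun _ => ∑ i ∈ A, π i with hφ
  have hA0 : 0 ≤ ∑ i ∈ A, π i := Finset.sum_nonneg fun i _ => hπ.nonneg i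
  have hA1 : ∑ i ∈ A, π i ≤ 1 := by
    rw [← hπ.sum_eq_one]
    exact Finset.sum_le_sum_of_subset_of_nonneg (Finset.subset_univ A) fun y _ _ => hπ.nonneg y
  have hφ1 : ∀ y, |φ y| ≤ 1 := by
    intro y
    simp only [hφ, Pi.sub_apply]
    rw [abs_le]
    split_ifs <;> constructor <;> linarith
  have hφ0 : ∑ y, π y * φ y = 0 := by
    simp only [hφ, Pi.sub_apply, mul_sub, Finset.sum_sub_distrib, ← Finset.sum_mul, hπ.sum_eq_one]
    simp
  have hval : (P ^ (v + u) *ᵥ φ) x = ∑ i ∈ A, (P ^ (v + u)) x i - ∑ i ∈ A, π i := by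
    rw [hφ, mulVec_sub, Pi.sub_apply, mulVec_const_of_rowStochastic (pow_mem hP _)]
    simp [mulVec, dotProduct]
  have hβ : ∀ j, v ≤ j → |(P ^ j *ᵥ φ) i₀| ≤ ε / 2 := by
    intro j hj
    have hj' : 4 * (T / (1 - δ)) ≤ j := hv.trans (Nat.cast_le.2 hj)
    have h1 := hdb.mul_sq_pow_mulVec_le hP hπ.nonneg hπ.sum_eq_one
      ((detailedBalance hπ).inner_lazyMatrix_nonneg C.K_mem_rowStochastic hπ.nonneg hδ hδ1.le)
      (hπ.pos hK i₀) hc hitMean_self (hitMean_le_tMax hπ.nonneg) hdrift hφ1 hφ0 j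
    refine abs_le_of_sq_le_sq ?_ (by linarith)
    have h2 := mul_le_mul_of_nonneg_right hj' (sq_nonneg ((P ^ j *ᵥ φ) i₀))
    have h3 : T / (1 - δ) * (4 * (P ^ j *ᵥ φ) i₀ ^ 2) ≤ T / (1 - δ) * ε ^ 2 := by
      rw [← htc]; linarith
    have h4 := le_of_mul_le_mul_left h3 hTc0
    linarith
  have hs : survival P i₀ u x ≤ ε / 3 := by
    have h1 := hsurv u x
    have h2 := mul_le_mul_of_nonneg_right hu1 (survival_nonneg hP i₀ u x)
    have h3 : T / (1 - δ) * (3 * survival P i₀ u x) ≤ T / (1 - δ) * ε ^ 2 := by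
      rw [← htc]; linarith
    have h4 := le_of_mul_le_mul_left h3 hTc0
    nlinarith
  have := abs_pow_add_mulVec_le hP hφ1 (by linarith) v hβ u x
  rw [← hval]
  exact (le_abs_self _).trans (this.trans (by linarith))

theorem maxTVDist_heatSemigroup_le (hK : C.K.IsIrreducible)
    (hπ : IsStationaryDistribution C.K π) (hn : n ≠ 0) {ε : ℝ} (hε : 0 < ε) (hε1 : ε < 1) :
    maxTVDist (heatSemigroup C.K (9 * C.tMax π i₀ / ε ^ 2)) π ≤ ε := by
  have ht1 : 1 ≤ C.tMax π i₀ := one_le_tMax hK hπ hn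
  set s := 9 * C.tMax π i₀ / ε ^ 2 with hs
  have hs0 : 0 < s := by positivity
  rw [maxTVDist_le_iff]
  intro x A
  have hl : Tendsto (fun m : ℕ => ∑ i ∈ A, (lazyMatrix C.K (1 - s / m) ^ m) x i - ∑ i ∈ A, π i)
      atTop (𝓝 (∑ i ∈ A, heatSemigroup C.K s x i - ∑ i ∈ A, π i)) :=
    (tendsto_finsetSum _ fun i _ => tendsto_lazyMatrix_pow_apply C.K s x i).sub
      tendsto_const_nhds
  refine le_of_tendsto hl ?_
  filter_upwards [eventually_lazy_param hs0.le] with m hm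
  have hm0 : (0 : ℝ) < m := Nat.cast_pos.2 hm.1
  refine maxTVDist_le_iff.1 (maxTVDist_lazyMatrix_pow_le (i₀ := i₀) hK hπ hn hm.2.1 ?_ hε hε1 ?_)
    x A
  · have := div_pos hs0 hm0
    linarith
  · rw [sub_sub_cancel, mul_div_cancel₀ _ hm0.ne', hs]
    gcongr
    norm_num

/-- A chain with a single state is mixed at time `0`. -/
theorem maxTVDist_one_le (hπ : IsStationaryDistribution C.K π) (hn : n = 0) {ε : ℝ} (hε : 0 ≤ ε) :
    maxTVDist (1 : Matrix (Fin (n + 1)) (Fin (n + 1)) ℝ) π ≤ ε := by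
  subst hn
  rw [maxTVDist_le_iff]
  intro x A
  have h1 := hπ.sum_eq_one
  rw [Fin.sum_univ_one] at h1
  have e : ∀ i : Fin (0 + 1), (1 : Matrix (Fin (0 + 1)) (Fin (0 + 1)) ℝ) x i = π i := by
    intro i
    rw [Fin.fin_one_eq_zero x, Fin.fin_one_eq_zero i, Matrix.one_apply_eq, ← h1]
  simp only [e, sub_self, hε]

theorem tMax_nonneg (hπ : IsStationaryDistribution C.K π) : 0 ≤ C.tMax π i₀ :=
  (hitMean_nonneg hπ.nonneg i₀).trans (hitMean_le_tMax hπ.nonneg i₀)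

theorem mixingTimeCts_le (hK : C.K.IsIrreducible) (hπ : IsStationaryDistribution C.K π)
    {ε : ℝ} (hε : 0 < ε) (hε1 : ε < 1) :
    mixingTimeCts C.K π ε ≤ ENNReal.ofReal (9 * C.tMax π i₀ / ε ^ 2) := by
  rcases eq_or_ne n 0 with hn | hn
  · refine (iInf₂_le (f := fun (t : ℝ≥0) (_ : maxTVDist (heatSemigroup C.K (t : ℝ)) π ≤ ε) =>
      (t : ℝ≥0∞)) 0 ?_).trans (by simp)
    have : heatSemigroup C.K ((0 : ℝ≥0) : ℝ) = 1 := by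
      simp [heatSemigroup, NormedSpace.exp_zero]
    rw [this]
    exact maxTVDist_one_le hπ hn hε.le
  · refine iInf₂_le (f := fun (t : ℝ≥0) (_ : maxTVDist (heatSemigroup C.K (t : ℝ)) π ≤ ε) =>
      (t : ℝ≥0∞)) _ ?_
    have h0 : 0 ≤ 9 * C.tMax π i₀ / ε ^ 2 := by
      have := tMax_nonneg (i₀ := i₀) hπ
      positivity
    rw [Real.coe_toNNReal _ h0]
    exact maxTVDist_heatSemigroup_le hK hπ hn hε hε1

/-- Rounding the time `8 t / ((1 - δ) ε²)` up to an integer costs at most `1 - δ ≤ t / ε²` on the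
time scale of the continuous chain, so `9 t / ε²` suffices. -/
theorem exists_mixingTime_le (hK : C.K.IsIrreducible) (hπ : IsStationaryDistribution C.K π)
    {δ : ℝ} (hδ : 1 / 2 ≤ δ) (hδ1 : δ < 1) {ε : ℝ} (hε : 0 < ε) (hε1 : ε < 1) :
    ∃ m : ℕ, mixingTime (lazyMatrix C.K δ) π ε ≤ m ∧
      (1 - δ) * m ≤ 9 * C.tMax π i₀ / ε ^ 2 := by
  have hle : ∀ m : ℕ, maxTVDist (lazyMatrix C.K δ ^ m) π ≤ ε →
      mixingTime (lazyMatrix C.K δ) π ε ≤ m := fun m hm =>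
    iInf₂_le (f := fun (m : ℕ) (_ : maxTVDist (lazyMatrix C.K δ ^ m) π ≤ ε) => (m : ℝ≥0∞)) m hm
  have h0 := tMax_nonneg (i₀ := i₀) hπ
  rcases eq_or_ne n 0 with hn | hn
  · refine ⟨0, hle 0 ?_, ?_⟩
    · rw [pow_zero]
      exact maxTVDist_one_le hπ hn hε.le
    · rw [Nat.cast_zero, mul_zero]
      positivity
  · have hc : 0 < 1 - δ := by linarith
    have ht1 : 1 ≤ C.tMax π i₀ := one_le_tMax hK hπ hn
    set B := 8 * C.tMax π i₀ / ε ^ 2 / (1 - δ) with hB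
    refine ⟨⌈B⌉₊, hle _ (maxTVDist_lazyMatrix_pow_le (i₀ := i₀) hK hπ hn hδ hδ1 hε hε1 ?_), ?_⟩
    · rw [← div_le_iff₀ hc]
      exact Nat.le_ceil _
    · have hlt : (⌈B⌉₊ : ℝ) < B + 1 := Nat.ceil_lt_add_one (by positivity)
      have h1 : (1 - δ) * (⌈B⌉₊ : ℝ) ≤ (1 - δ) * (B + 1) := mul_le_mul_of_nonneg_left hlt.le hc.le
      have h2 : (1 - δ) * B = 8 * C.tMax π i₀ / ε ^ 2 := mul_div_cancel₀ _ hc.ne'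
      have h3 : 1 ≤ C.tMax π i₀ / ε ^ 2 := by
        rw [le_div_iff₀ (by positivity)]
        nlinarith
      have h4 : 8 * C.tMax π i₀ / ε ^ 2 = 8 * (C.tMax π i₀ / ε ^ 2) := by ring
      have h5 : 9 * C.tMax π i₀ / ε ^ 2 = 9 * (C.tMax π i₀ / ε ^ 2) := by ring
      linarith

end BirthDeathChain

/-! ### Mixing times in terms of hitting times -/

theorem theorem1p1 (n : ℕ) (C : BirthDeathChain n) (hK : C.K.IsIrreducible)
    (π : Fin (n + 1) → ℝ) (hπ : IsStationaryDistribution C.K π)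
    (i₀ : Fin (n + 1))
    (hleft : 1 / 2 ≤ ∑ i ∈ Finset.Iic i₀, π i)
    (hright : 1 / 2 ≤ ∑ i ∈ Finset.Ici i₀, π i) :
    -- the identity `t = max {𝔼_0 τ_{i₀}, 𝔼_n τ_{i₀}}`
    ENNReal.ofReal (C.tMax π i₀) =
      max (C.meanPassage 0 i₀) (C.meanPassage (Fin.last n) i₀) ∧
    ∀ δ : ℝ, 1 / 2 ≤ δ → δ < 1 →
      -- lower bounds
      ENNReal.ofReal (C.tMax π i₀ / 6) ≤
        min (mixingTimeCts C.K π (1 / 10)) (mixingTime (lazyMatrix C.K δ) π (1 / 20)) ∧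
      ENNReal.ofReal (C.tMax π i₀ / 6) ≤
        ENNReal.ofReal (2 * (1 - δ)) * mixingTime (lazyMatrix C.K δ) π (1 / 20) ∧
      -- upper bounds
      ∀ ε : ℝ, 0 < ε → ε < 1 →
        max (mixingTimeCts C.K π ε)
            (ENNReal.ofReal (1 - δ) * mixingTime (lazyMatrix C.K δ) π ε) ≤
          9 * (C.meanPassage 0 i₀ + C.meanPassage (Fin.last n) i₀) / ENNReal.ofReal (ε ^ 2) ∧
        max (mixingTimeCts C.K π ε)
            (ENNReal.ofReal (2 * (1 - δ)) * mixingTime (lazyMatrix C.K δ) π ε) ≤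
          ENNReal.ofReal (18 * C.tMax π i₀ / ε ^ 2) := by
  have ht0 : 0 ≤ C.tMax π i₀ := BirthDeathChain.tMax_nonneg hπ
  have h0 : 0 ≤ C.hitMean π i₀ 0 := BirthDeathChain.hitMean_nonneg hπ.nonneg _
  have h1 : 0 ≤ C.hitMean π i₀ (Fin.last n) := BirthDeathChain.hitMean_nonneg hπ.nonneg _
  rw [BirthDeathChain.meanPassage_eq hK hπ, BirthDeathChain.meanPassage_eq hK hπ]
  refine ⟨?_, fun δ hδ hδ1 => ?_⟩
  · rw [BirthDeathChain.tMax_eq, ENNReal.ofReal_max]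
  have hc : 0 < 1 - δ := by linarith
  -- the argument gives the constant `9/20`, of which `1/12` is needed
  have hlow : ENNReal.ofReal (C.tMax π i₀ / (12 * (1 - δ))) ≤
      mixingTime (lazyMatrix C.K δ) π (1 / 20) := by
    refine le_iInf₂ fun m hm => ?_
    have := BirthDeathChain.tMax_le_of_lazy (i₀ := i₀) hK hπ hleft hright (by linarith) hδ1.le hm
    rw [← ENNReal.ofReal_natCast]
    refine ENNReal.ofReal_le_ofReal ?_
    rw [div_le_iff₀ (by positivity)]
    linarith
  refine ⟨le_min ?_ (le_trans ?_ hlow), ?_, fun ε hε hε1 => ?_⟩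
  · refine le_iInf₂ fun s hs => ?_
    have := BirthDeathChain.tMax_le_of_heat (i₀ := i₀) hK hπ hleft hright s.coe_nonneg hs
    rw [← ENNReal.ofReal_coe_nnreal]
    refine ENNReal.ofReal_le_ofReal ?_
    linarith
  · exact ENNReal.ofReal_le_ofReal (div_le_div_of_nonneg_left ht0 (by positivity) (by linarith))
  · refine le_trans (le_of_eq ?_) (mul_le_mul_right hlow _)
    rw [← ENNReal.ofReal_mul (by positivity)]
    congr 1
    field_simp
    ring
  · have hcts := BirthDeathChain.mixingTimeCts_le (i₀ := i₀) hK hπ hε hε1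
    obtain ⟨m, hm, hmc⟩ :=
      BirthDeathChain.exists_mixingTime_le (i₀ := i₀) hK hπ hδ hδ1 hε hε1
    have hε2 : 0 < ε ^ 2 := by positivity
    have hmul : ∀ a : ℝ, 0 ≤ a → ENNReal.ofReal a * mixingTime (lazyMatrix C.K δ) π ε ≤
        ENNReal.ofReal (a * m) := by
      intro a ha
      rw [ENNReal.ofReal_mul ha, ENNReal.ofReal_natCast]
      exact mul_le_mul_right hm _
    have hsum : ENNReal.ofReal (9 * C.tMax π i₀ / ε ^ 2) ≤ 9 * (ENNReal.ofReal (C.hitMean π i₀ 0)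
        + ENNReal.ofReal (C.hitMean π i₀ (Fin.last n))) / ENNReal.ofReal (ε ^ 2) := by
      rw [ENNReal.ofReal_div_of_pos hε2, ENNReal.ofReal_mul (by norm_num),
        ← ENNReal.ofReal_add h0 h1, BirthDeathChain.tMax_eq,
        show ENNReal.ofReal 9 = 9 by norm_num]
      gcongr
      exact max_le (by linarith) (by linarith)
    refine ⟨max_le (hcts.trans hsum) ?_, max_le (hcts.trans ?_) ?_⟩
    · exact (hmul _ hc.le).trans ((ENNReal.ofReal_le_ofReal hmc).trans hsum)
    · refine ENNReal.ofReal_le_ofReal ?_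
      gcongr
      norm_num
    · refine (hmul _ (by positivity)).trans (ENNReal.ofReal_le_ofReal ?_)
      have : 18 * C.tMax π i₀ / ε ^ 2 = 2 * (9 * C.tMax π i₀ / ε ^ 2) := by ring
      rw [this]
      linarith
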